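/- Model. A randomized streaming algorithm with word length $b$, space $S$ and $P$ passes has a memory of $S$ words of $b$ bits each, which holds everything it remembers between arrivals of edges and between passes; it starts from a fixed memory content, reads the same stream $P$ times in the same order, and updates its memory after each arriving edge and at the end of each pass, using fresh random bits. Its output is a function of the memory after the last pass. Local computation between arrivals is not charged. For a finite undirected simple graph $G=(V,E,w)$ with non-negative real edge weights, $\mathrm{dist}_G(u,v)$ is the least total weight of a walk from $u$ to $v$ in $G$ ($\infty$ if there is none). A $(1+\varepsilon)$-approximate shortest-path tree of $G$ rooted at $s\in V$ is a subgraph $T$ of $G$ which is a tree whose vertex set is the connected component of $s$ in $G$ (so a spanning tree if $G$ is connected), and which satisfies $\mathrm{dist}_T(s,v)\le(1+\varepsilon)\,\mathrm{dist}_G(s,v)$ for all $v$ in this component. Theorem. There are absolute constants $C,c>0$ such that the following holds. Let $n,k,b$ be integers with $1\le k\le\ln n$ and $2^b\ge n$, let $\varepsilon\in(0,1)$, let $V$ be a set of $n$ vertices, let $s\in V$, and fix any format in which each $b$-bit word represents a non-negative real number. Then there is a randomized streaming algorithm with word length $b$ which uses at most $$C\cdot\frac{k}{\varepsilon}\cdot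 n^{1+1/k}\cdot\log_2 n\ \text{ words of space}\qquad\text{and at most}\qquad C\cdot\frac{k^2}{\varepsilon}\ \text{ passes},$$ such that for every undirected simple graph $G=(V,E,w)$ whose edge weights are each represented by one word, and for every insertion-only stream of $G$ (each edge arrives exactly once, together with the word of its weight, in arbitrary order), the output of the algorithm is a $(1+\varepsilon)$-approximate shortest-path tree of $G$ rooted at $s$ with probability at least $1-n^{-cn}$. -/

import Mathlib

open scoped NNReal ENNReal

namespace Streaming

/-- A machine word of `b` bits. -/
abbrev Word (b : ℕ) : Type := Fin b → Bool

/-- A randomized multi-pass streaming algorithm reading tokens from `Tok`, with `b`-bit machine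
words. Its whole memory consists of `space` words: everything that it remembers between two tokens
or two passes (a pass counter included) has to be stored there. A transition may use fresh random
bits and unrestricted local computation, as usual in the streaming model, where the resources are
the memory and the number of passes. -/
structure StreamingAlgorithm (b : ℕ) (Tok Out : Type) where
  /-- the number of words of memory, in the worst case over inputs and random bits -/
  space : ℕ
  /-- the number of passes over the input stream -/
  passes : ℕ
  /-- the initial memory -/
  init : Fin space → Word b
  /-- the (random) memory after the arrival of a token -/
  step : (Fin space → Word b) → Tok → PMF (Fin space → Word b)
  /-- the (random) memory after the end of a pass -/
  endPass : (Fin space → Word b) → PMF (Fin space → Word b)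
  /-- the output, computed from the memory after the last pass -/
  output : (Fin space → Word b) → Out

namespace StreamingAlgorithm

variable {b : ℕ} {Tok Out : Type}

/-- One pass over a stream, from the given memory: the tokens are processed one by one, in order. -/
noncomputable def runPass (A : StreamingAlgorithm b Tok Out) :
    List Tok → (Fin A.space → Word b) → PMF (Fin A.space → Word b)
  | [], m => A.endPass m
  | e :: σ, m => (A.step m e).bind (runPass A σ)

/-- The distribution of the memory after a number of passes over the same stream. -/
noncomputable def run (A : StreamingAlgorithm b Tok Out) (σ : List Tok) :
    ℕ → PMF (Fin A.space → Word b)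
  | 0 => PMF.pure A.init
  | p + 1 => (run A σ p).bind (A.runPass σ)

/-- The distribution of the output on the stream `σ`. -/
noncomputable def outputDist (A : StreamingAlgorithm b Tok Out) (σ : List Tok) : PMF Out :=
  (A.run σ A.passes).map A.output

end StreamingAlgorithm

/-- `σ` is an insertion-only stream of the undirected graph `G` whose edge `e` has the weight stored
in the word `w e`: every edge of `G` arrives exactly once, with its weight, in an arbitrary order. -/
def IsInsertionStream {V : Type} {b : ℕ} (G : SimpleGraph V) (w : Sym2 V → Word b)
    (σ : List (Sym2 V × Word b)) : Prop :=
  (σ.map Prod.fst).Nodup ∧ ∀ e x, (e, x) ∈ σ ↔ e ∈ G.edgeSet ∧ x = w e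

/-- Weighted distance: the least total weight of a walk, and `∞` if there is no walk. -/
noncomputable def wdist {V : Type} (G : SimpleGraph V) (w : Sym2 V → ℝ≥0) (u v : V) : ℝ≥0∞ :=
  ⨅ p : G.Walk u v, (((p.edges.map w).sum : ℝ≥0) : ℝ≥0∞)

/-- `T` is a `(1 + ε)`-approximate shortest-path tree of `G` rooted at `s`: a subgraph of `G` which
is a tree on the connected component of `s` in `G` (with no edges elsewhere; hence a spanning tree
if `G` is connected) and in which all distances from `s` are within a factor `1 + ε` of those
in `G`. -/
structure IsApproxShortestPathTree {V : Type} (G : SimpleGraph V) (w : Sym2 V → ℝ≥0) (s : V)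
    (ε : ℝ) (T : SimpleGraph V) : Prop where
  le : T ≤ G
  acyclic : T.IsAcyclic
  reachable_of_adj : ∀ u v, T.Adj u v → T.Reachable s u
  reachable_iff : ∀ v, T.Reachable s v ↔ G.Reachable s v
  wdist_le : ∀ v, wdist T w s v ≤ ENNReal.ofReal (1 + ε) * wdist G w s v

end Streaming

/-! A skeleton of three edge sets, fixed in two deterministic passes, makes every mistake of a later
round cheap. Multiplicative weights make mistakes rare, and averaging over the rounds turns this
into a factor `1 + ε`.

Skeleton. A minimum spanning forest `F` joins the ends of an edge of weight `ω` by fewer than `n`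
edges of weight at most `ω`, so its root distance `D` is at most `n` times the true one. Consider an
edge `uv` of weight `ω`, traversed towards `v`. If `D v ≤ ω`, reaching `v` through `F` costs no more
than the edge itself. If `ω` is smaller than the total length by a large polynomial factor, the
detour of cost `n ω` in `F` is negligible. In between, each vertex sees only `m + 1` powers of two.
If `ω` is below `D` at both ends, a greedy spanner `H`, built separately for each power of two and
without cycles of length at most `2 k`, gives stretch `4 k`; the Moore bound
`LocallyAcyclic.card_le` and the count of scales per vertex give `IsGreedySpanner.card_le`. If `D u
≤ ω < D v`, the scales at `u` are not controlled, and one stored edge ("hook") per vertex and scale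
suffices: `IsHookSet.le_four_mul`.

Rounds. Each of `R` rounds samples edges at a rate proportional to `B ^ j`, where `B = n ^ (1 / k)`
and `j` counts the earlier trees that violate the edge, that is, whose distances could be improved
by it. The round stores a shortest-path tree of `F`, `H`, the hooks and the sample. Sampled edges
are not violated by this tree, so a union bound over all candidate trees shows that the violated
edges have small total rate (`toOuterMeasure_round_le`). The total importance then grows by a factor
of at most `1 + k / R` per round and ends below `n ^ 2 * exp k ≤ n ^ 3 = B ^ (3 k)`; hence no edge
is violated more than `3 k` times.

Averaging. Summed over all trees, a middle edge costs at most `R ω + 3 k * 4 k ω`, and the excess is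
at most `ε R ω / 2`. So for each `z` some tree, depending on `z`, has distance at most `(1 + ε)`
times the true one (`exists_le_one_add_mul_wdist`). A shortest-path tree of the union of all stored
trees serves all `z` at once.

When `ε n < 1`, the space bound allows storing the whole graph. -/

namespace Streaming

/-! ### Weighted distances and exact shortest-path trees. -/

section WeightedDistance

variable {V : Type} {G G' : SimpleGraph V} {w w' : Sym2 V → ℝ≥0} {s u v x : V}

lemma wdist_le_walk (p : G.Walk u v) :
    wdist G w u v ≤ (((p.edges.map w).sum : ℝ≥0) : ℝ≥0∞) := iInf_le _ p

lemma wdist_self : wdist G w u u = 0 := by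
  have := wdist_le_walk (w := w) (SimpleGraph.Walk.nil : G.Walk u u)
  simpa using this

lemma wdist_triangle : wdist G w u x ≤ wdist G w u v + wdist G w v x := by
  unfold wdist
  rw [ENNReal.iInf_add]
  refine le_iInf fun p => ?_
  rw [ENNReal.add_iInf]
  refine le_iInf fun q => ?_
  refine (iInf_le _ (p.append q)).trans ?_
  simp

lemma wdist_adj (h : G.Adj u v) : wdist G w u v ≤ w s(u, v) := by
  have := wdist_le_walk (w := w) (SimpleGraph.Walk.cons h .nil)
  simpa using this

lemma wdist_mono (h : G ≤ G') : wdist G' w u v ≤ wdist G w u v := by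
  refine le_iInf fun p => ?_
  have := wdist_le_walk (w := w) (p.mapLe h)
  simpa using this

lemma wdist_congr_weight (h : ∀ e ∈ G.edgeSet, w e = w' e) : wdist G w u v = wdist G w' u v := by
  unfold wdist
  refine iInf_congr fun p => ?_
  rw [List.map_congr_left fun e he => h e (p.edges_subset_edgeSet he)]

lemma wdist_eq_top (h : ¬ G.Reachable u v) : wdist G w u v = ⊤ := by
  unfold wdist
  rw [iInf_eq_top]
  exact fun p => absurd ⟨p⟩ h

lemma wdist_ne_top (h : G.Reachable u v) : wdist G w u v ≠ ⊤ := by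
  obtain ⟨p⟩ := h
  exact ne_top_of_le_ne_top ENNReal.coe_ne_top (wdist_le_walk p)

lemma wdist_ne_top_iff : wdist G w u v ≠ ⊤ ↔ G.Reachable u v :=
  ⟨fun h => by_contra fun h' => h (wdist_eq_top h'), wdist_ne_top⟩

/-- Walks bound a distance: few steps of bounded weight. -/
lemma wdist_le_length_mul (p : G.Walk u v) (c : ℝ≥0) (h : ∀ e ∈ p.edges, w e ≤ c) :
    wdist G w u v ≤ p.length * c := by
  refine (wdist_le_walk p).trans ?_
  have h1 : (p.edges.map w).sum ≤ p.length * c := by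
    have := List.sum_le_card_nsmul (p.edges.map w) c (by
      intro x hx
      obtain ⟨e, he, rfl⟩ := List.mem_map.1 hx
      exact h e he)
    simpa using this
  exact_mod_cast h1

/-- A function which increases along every edge by at most its weight grows at most like the
distance. -/
lemma le_add_wdist_of_adj (d : V → ℝ≥0∞) (h : ∀ a b, G.Adj a b → d b ≤ d a + w s(a, b)) :
    d v ≤ d u + wdist G w u v := by
  unfold wdist
  rw [ENNReal.add_iInf]
  refine le_iInf fun p => ?_
  induction p with
  | nil => simp
  | cons hab p ih =>
    refine ih.trans ?_
    simp only [SimpleGraph.Walk.edges_cons, List.map_cons, List.sum_cons, ENNReal.coe_add]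
    rw [← add_assoc]
    gcongr
    exact h _ _ hab

/-- A walk that starts inside `A` and ends outside has a first edge leaving `A`. -/
lemma exists_leaving_edge (A : Set V) (p : G.Walk u v) (hu : u ∈ A) (hv : v ∉ A) :
    ∃ a b, a ∈ A ∧ b ∉ A ∧ G.Adj a b ∧
      wdist G w u a + w s(a, b) ≤ (((p.edges.map w).sum : ℝ≥0) : ℝ≥0∞) := by
  induction p with
  | nil => exact absurd hu hv
  | @cons x y z hxy p ih =>
    by_cases hy : y ∈ A
    · obtain ⟨a, b, ha, hb, hab, hle⟩ := ih hy hv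
      refine ⟨a, b, ha, hb, hab, ?_⟩
      simp only [SimpleGraph.Walk.edges_cons, List.map_cons, List.sum_cons, ENNReal.coe_add]
      calc wdist G w x a + w s(a, b) ≤ (wdist G w x y + wdist G w y a) + w s(a, b) := by
            gcongr; exact wdist_triangle
        _ ≤ (w s(x, y) + wdist G w y a) + w s(a, b) := by gcongr; exact wdist_adj hxy
        _ ≤ _ := by rw [add_assoc]; gcongr
    · refine ⟨x, y, hu, hy, hxy, ?_⟩
      simp [wdist_self]

/-- Every finite graph with non-negative weights has an exact shortest-path tree. -/
theorem exists_shortestPathTree [Finite V] (G : SimpleGraph V) (w : Sym2 V → ℝ≥0) (s : V) :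
    ∃ T, IsApproxShortestPathTree G w s 0 T := by
  classical
  have := Fintype.ofFinite V
  -- Dijkstra's algorithm as an extremal argument: a largest vertex set carrying a tree with exact
  -- distances must be the whole component, since the cheapest leaving edge would extend it.
  let P : Finset V → SimpleGraph V → Prop := fun A T =>
    s ∈ A ∧ T ≤ G ∧ T.IsAcyclic ∧ (∀ a b, T.Adj a b → a ∈ A) ∧
      ∀ a ∈ A, T.Reachable s a ∧ wdist T w s a ≤ wdist G w s a
  have hne : (Finset.univ.filter fun A => ∃ T, P A T).Nonempty := by
    refine ⟨{s}, ?_⟩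
    simp only [Finset.mem_filter, Finset.mem_univ, true_and]
    refine ⟨⊥, by simp, bot_le, SimpleGraph.isAcyclic_bot, by simp, ?_⟩
    intro a ha
    obtain rfl : a = s := by simpa using ha
    exact ⟨.refl _, by simp [wdist_self]⟩
  obtain ⟨A, hA, hmax⟩ := Finset.exists_max_image _ Finset.card hne
  obtain ⟨T, hs, hTG, hac, hin, hd⟩ := (Finset.mem_filter.1 hA).2
  have hall : ∀ v, G.Reachable s v → v ∈ A := by
    by_contra! hcon
    obtain ⟨v, ⟨p⟩, hv⟩ := hcon
    obtain ⟨a, b, ha, hb, hab, -⟩ := exists_leaving_edge (w := w) (A : Set V) p hs hv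
    let X := Finset.univ.filter fun q : V × V => q.1 ∈ A ∧ q.2 ∉ A ∧ G.Adj q.1 q.2
    have hX : X.Nonempty := ⟨(a, b), by simpa [X] using ⟨ha, hb, hab⟩⟩
    obtain ⟨⟨a, b⟩, hq, hmin⟩ :=
      Finset.exists_min_image X (fun q => wdist G w s q.1 + w s(q.1, q.2)) hX
    obtain ⟨ha, hb, hab⟩ : a ∈ A ∧ b ∉ A ∧ G.Adj a b := by simpa [X] using hq
    -- Every walk to `b` leaves `A` through some edge of `X`, and already pays at least the minimum
    -- there.
    have hlow : wdist G w s a + w s(a, b) ≤ wdist G w s b := by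
      refine le_iInf fun p => ?_
      obtain ⟨a', b', ha', hb', hab', hle⟩ := exists_leaving_edge (w := w) (A : Set V) p hs hb
      exact (hmin (a', b') (by simpa [X] using ⟨ha', hb', hab'⟩)).trans hle
    have hTab : ¬ T.Reachable a b := by
      rintro ⟨p⟩
      obtain ⟨a', b', -, hb', hab', -⟩ := exists_leaving_edge (w := w) (A : Set V) p ha hb
      exact hb' (hin _ _ hab'.symm)
    let T' := T ⊔ SimpleGraph.fromEdgeSet {s(a, b)}
    have hTT' : T ≤ T' := le_sup_left
    have hadj : T'.Adj a b := by
      refine SimpleGraph.sup_adj _ _ _ _ |>.2 (Or.inr ?_)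
      simp [hab.ne]
    have hP : P (insert b A) T' := by
      refine ⟨Finset.mem_insert_of_mem hs, sup_le hTG ?_, ?_, ?_, ?_⟩
      · intro c d h
        simp only [SimpleGraph.fromEdgeSet_adj, Set.mem_singleton_iff, Sym2.eq_iff] at h
        rcases h with ⟨⟨rfl, rfl⟩ | ⟨rfl, rfl⟩, -⟩
        · exact hab
        · exact hab.symm
      · exact SimpleGraph.isAcyclic_add_edge_iff_of_not_reachable a b hTab |>.2 hac
      · intro c d h
        rcases (SimpleGraph.sup_adj _ _ _ _).1 h with h | h
        · exact Finset.mem_insert_of_mem (hin _ _ h)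
        · simp only [SimpleGraph.fromEdgeSet_adj, Set.mem_singleton_iff, Sym2.eq_iff] at h
          rcases h with ⟨⟨rfl, rfl⟩ | ⟨rfl, rfl⟩, -⟩
          · exact Finset.mem_insert_of_mem ha
          · exact Finset.mem_insert_self _ _
      · intro c hc
        rcases Finset.mem_insert.1 hc with rfl | hc
        · refine ⟨((hd a ha).1.mono hTT').trans hadj.reachable, ?_⟩
          refine (wdist_triangle (v := a)).trans ?_
          refine le_trans ?_ hlow
          gcongr
          · exact (wdist_mono hTT').trans (hd a ha).2
          · exact wdist_adj hadj
        · exact ⟨(hd c hc).1.mono hTT', (wdist_mono hTT').trans (hd c hc).2⟩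
    have := hmax (insert b A) (by simpa using ⟨T', hP⟩)
    rw [Finset.card_insert_of_notMem hb] at this
    omega
  refine ⟨T, hTG, hac, fun u v h => (hd u (hin u v h)).1, fun v => ⟨fun h => h.mono hTG,
    fun h => (hd v (hall v h)).1⟩, fun v => ?_⟩
  by_cases hv : G.Reachable s v
  · simpa using (hd v (hall v hv)).2
  · simp [wdist_eq_top hv]

end WeightedDistance

/-- An acyclic graph has at most as many edges as vertices. -/
lemma card_le_of_isAcyclic {V : Type} [Fintype V] (E : Finset (Sym2 V))
    (hE : ∀ e ∈ E, ¬ e.IsDiag) (h : (SimpleGraph.fromEdgeSet (E : Set (Sym2 V))).IsAcyclic) :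
    E.card ≤ Fintype.card V := by
  classical
  cases isEmpty_or_nonempty V
  · have : E = ∅ := Finset.eq_empty_of_isEmpty E
    simp [this]
  obtain ⟨T, hle, -, hT⟩ := SimpleGraph.Connected.exists_isTree_le_of_le_of_isAcyclic
    (G := ⊤) (SimpleGraph.connected_top) le_top h
  have hc := hT.card_edgeFinset
  have : E ⊆ T.edgeFinset := by
    intro e he
    rw [SimpleGraph.mem_edgeFinset]
    refine SimpleGraph.edgeSet_mono hle ?_
    rw [SimpleGraph.edgeSet_fromEdgeSet]
    exact ⟨he, hE e he⟩
  have := Finset.card_le_card this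
  omega

/-! ### Minimum spanning forests and the bottleneck property. -/

section SpanningForest

variable {V W : Type}

/-- The graph formed by a set of tokens. -/
def graphOf (A : Set (Sym2 V × W)) : SimpleGraph V := SimpleGraph.fromEdgeSet (Prod.fst '' A)

lemma graphOf_mono {A B : Set (Sym2 V × W)} (h : A ⊆ B) : graphOf A ≤ graphOf B :=
  SimpleGraph.fromEdgeSet_mono (Set.image_mono h)

lemma graphOf_adj {A : Set (Sym2 V × W)} {u v : V} :
    (graphOf A).Adj u v ↔ (∃ x ∈ A, x.1 = s(u, v)) ∧ u ≠ v := by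
  simp only [graphOf, SimpleGraph.fromEdgeSet_adj, Set.mem_image]

/-- The endpoints of the token `x` are connected by tokens of `A` which are at most as heavy. -/
def BottleneckConnected (val : W → ℝ≥0) (A : Set (Sym2 V × W)) (x : Sym2 V × W) : Prop :=
  ∀ u v, x.1 = s(u, v) → (graphOf {y | y ∈ A ∧ val y.2 ≤ val x.2}).Reachable u v

lemma BottleneckConnected.mono {val : W → ℝ≥0} {A B : Set (Sym2 V × W)} {x : Sym2 V × W}
    (h : BottleneckConnected val A x) (hAB : A ⊆ B) : BottleneckConnected val B x :=
  fun u v huv => (h u v huv).mono (graphOf_mono fun _ hy => ⟨hAB hy.1, hy.2⟩)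

lemma bottleneckConnected_of_mem {val : W → ℝ≥0} {A : Set (Sym2 V × W)} {x : Sym2 V × W}
    (hx : x ∈ A) : BottleneckConnected val A x := by
  intro u v huv
  by_cases h : u = v
  · subst h; exact .refl _
  · exact (graphOf_adj.2 ⟨⟨x, show x ∈ A ∧ _ from ⟨hx, le_rfl⟩, huv⟩, h⟩).reachable

lemma reachable_of_forall_adj {G H : SimpleGraph V} (h : ∀ u v, G.Adj u v → H.Reachable u v)
    {u v : V} (huv : G.Reachable u v) : H.Reachable u v := by
  obtain ⟨p⟩ := huv
  induction p with
  | nil => exact .refl _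
  | cons hab p ih => exact (h _ _ hab).trans ih

/-- Each token of the connection in `A` is rerouted through tokens of `B` no heavier than itself,
hence no heavier than `x`. This makes the forest maintainable online: tokens discarded earlier stay
connected after every update. -/
lemma BottleneckConnected.trans {val : W → ℝ≥0} {A B : Set (Sym2 V × W)} {x : Sym2 V × W}
    (h : BottleneckConnected val A x) (hAB : ∀ y ∈ A, BottleneckConnected val B y) :
    BottleneckConnected val B x := by
  intro u v huv
  refine reachable_of_forall_adj (fun a b hab => ?_) (h u v huv)
  obtain ⟨⟨y, ⟨hyA, hyx⟩, hy⟩, -⟩ := graphOf_adj.1 hab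
  exact (hAB y hyA a b hy).mono (graphOf_mono fun z hz => ⟨hz.1, hz.2.trans hyx⟩)

/-- A minimum spanning forest, by Kruskal's algorithm. -/
theorem exists_minimumSpanningForest [Fintype V] (val : W → ℝ≥0) (E : Finset (Sym2 V × W))
    (hE : ∀ x ∈ E, ¬ x.1.IsDiag) :
    ∃ F : Finset (Sym2 V × W), F ⊆ E ∧ F.card ≤ Fintype.card V ∧
      ∀ x ∈ E, BottleneckConnected val (F : Set (Sym2 V × W)) x := by
  classical
  -- `E` may contain one edge with several weights; injectivity of `Prod.fst` on `F` lets the edge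
  -- count of an acyclic graph bound the number of tokens.
  have key : ∃ F : Finset (Sym2 V × W), F ⊆ E ∧ Set.InjOn Prod.fst (F : Set (Sym2 V × W)) ∧
      (graphOf (F : Set (Sym2 V × W))).IsAcyclic ∧
      ∀ x ∈ E, BottleneckConnected val (F : Set (Sym2 V × W)) x := by
    clear hE
    -- The token added last is a heaviest one, so any connection of its ends in `F` respects its
    -- bottleneck automatically.
    induction E using Finset.induction_on_max_value (fun x : Sym2 V × W => val x.2) with
    | empty => exact ⟨∅, by simp, by simp, by simp [graphOf], by simp⟩
    | insert x E hx hmax ih =>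
      obtain ⟨F, hFE, hinj, hac, hb⟩ := ih
      obtain ⟨⟨u, v⟩, ω⟩ := x
      by_cases hr : (graphOf (F : Set (Sym2 V × W))).Reachable u v
      · refine ⟨F, hFE.trans (Finset.subset_insert _ _), hinj, hac, fun y hy => ?_⟩
        rcases Finset.mem_insert.1 hy with rfl | hy
        · intro a b hab
          have : (F : Set (Sym2 V × W)) ⊆ {y | y ∈ (F : Set (Sym2 V × W)) ∧ val y.2 ≤ val ω} :=
            fun z hz => ⟨hz, hmax z (hFE hz)⟩
          rcases Sym2.eq_iff.1 (show s(u, v) = s(a, b) from hab) with ⟨rfl, rfl⟩ | ⟨rfl, rfl⟩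
          · exact hr.mono (graphOf_mono this)
          · exact hr.symm.mono (graphOf_mono this)
        · exact hb y hy
      · have hsub : (F : Set (Sym2 V × W)) ⊆ (insert (s(u, v), ω) F : Finset _) := by simp
        refine ⟨insert (s(u, v), ω) F, Finset.insert_subset_insert _ hFE, ?_, ?_, ?_⟩
        · rw [Finset.coe_insert, Set.injOn_insert]
          · refine ⟨hinj, ?_⟩
            rintro ⟨y, hy, hyx⟩
            have := bottleneckConnected_of_mem (val := val) hy u v hyx
            exact hr (this.mono (graphOf_mono fun z hz => hz.1))
          · intro h
            have := bottleneckConnected_of_mem (val := val) h u v rfl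
            exact hr (this.mono (graphOf_mono fun z hz => hz.1))
        · have : graphOf ((insert (s(u, v), ω) F : Finset (Sym2 V × W)) : Set (Sym2 V × W)) =
              graphOf (F : Set (Sym2 V × W)) ⊔ SimpleGraph.edge u v := by
            ext a b
            simp only [graphOf, Finset.coe_insert, Set.image_insert_eq, SimpleGraph.edge,
              SimpleGraph.sup_adj, SimpleGraph.fromEdgeSet_adj, Set.mem_insert_iff,
              Set.mem_singleton_iff]
            tauto
          rw [this]
          exact hac.sup_edge_of_not_reachable hr
        · intro y hy
          rcases Finset.mem_insert.1 hy with rfl | hy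
          · exact bottleneckConnected_of_mem (by simp)
          · exact (hb y hy).mono hsub
  obtain ⟨F, hFE, hinj, hac, hb⟩ := key
  refine ⟨F, hFE, ?_, hb⟩
  rw [← Finset.card_image_of_injOn hinj]
  refine card_le_of_isAcyclic _ ?_ ?_
  · intro e he
    obtain ⟨x, hx, rfl⟩ := Finset.mem_image.1 he
    exact hE x (hFE hx)
  · simpa [graphOf] using hac

end SpanningForest

/-! ### Graphs of large girth and the Moore bound. -/

section Girth

variable {V : Type}

/-- All sets of at most `m` edges are acyclic. -/
def LocallyAcyclic (m : ℕ) (E : Finset (Sym2 V)) : Prop :=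
  ∀ F ⊆ E, F.card ≤ m → (SimpleGraph.fromEdgeSet (F : Set (Sym2 V))).IsAcyclic

lemma LocallyAcyclic.subset {m : ℕ} {E E' : Finset (Sym2 V)} (h : LocallyAcyclic m E)
    (hE : E' ⊆ E) : LocallyAcyclic m E' := fun F hF => h F (hF.trans hE)

/-- A cycle among at most `m` edges that uses the new edge would leave a path of at most `m - 1` old
edges between its ends. -/
lemma locallyAcyclic_insert [DecidableEq V] {m : ℕ} {E : Finset (Sym2 V)}
    (h : LocallyAcyclic m E) {u v : V}
    (huv : ∀ p : (SimpleGraph.fromEdgeSet (E : Set (Sym2 V))).Walk u v, m ≤ p.length) :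
    LocallyAcyclic m (insert s(u, v) E) := by
  intro F hF hcard
  by_cases hmem : s(u, v) ∈ F
  swap
  · exact h F ((Finset.subset_insert_iff_of_notMem hmem).1 hF) hcard
  set F' := F.erase s(u, v) with hF'
  have hF'E : F' ⊆ E := Finset.subset_insert_iff.1 hF
  have hcard' : F'.card + 1 = F.card := Finset.card_erase_add_one hmem
  have hac : (SimpleGraph.fromEdgeSet (F' : Set (Sym2 V))).IsAcyclic := h F' hF'E (by omega)
  have hnr : ¬ (SimpleGraph.fromEdgeSet (F' : Set (Sym2 V))).Reachable u v := by
    intro hr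
    obtain ⟨p, hp⟩ := hr.exists_isPath
    have h1 := huv (p.mapLe (SimpleGraph.fromEdgeSet_mono (by exact_mod_cast hF'E)))
    have h2 : p.edges.toFinset ⊆ F' := by
      intro e he
      have := p.edges_subset_edgeSet (List.mem_toFinset.1 he)
      rw [SimpleGraph.edgeSet_fromEdgeSet] at this
      exact_mod_cast this.1
    have h3 := Finset.card_le_card h2
    rw [List.toFinset_card_of_nodup hp.isTrail.edges_nodup, SimpleGraph.Walk.length_edges] at h3
    simp only [SimpleGraph.Walk.length_map, SimpleGraph.Walk.mapLe] at h1
    omega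
  have : SimpleGraph.fromEdgeSet (F : Set (Sym2 V)) =
      SimpleGraph.fromEdgeSet (F' : Set (Sym2 V)) ⊔ SimpleGraph.edge u v := by
    rw [SimpleGraph.edge, ← SimpleGraph.fromEdgeSet_union, hF', Finset.coe_erase]
    congr 1
    ext e
    by_cases he : e = s(u, v)
    · simpa [he] using hmem
    · simp [he]
  rw [this]
  exact hac.sup_edge_of_not_reachable hnr

/-- A shortest walk from `v` to a vertex `x` avoids every other vertex which is not closer to `v`
than `x`. -/
lemma notMem_support_of_length_le {G : SimpleGraph V} [DecidableEq V] {v x y : V} (p : G.Walk v x)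
    (hxy : y ≠ x) (hle : ∀ q : G.Walk v y, p.length ≤ q.length) : y ∉ p.support := by
  intro hy
  have h1 := hle (p.takeUntil y hy)
  have h2 : (p.takeUntil y hy).length + (p.dropUntil y hy).length = p.length := by
    rw [← SimpleGraph.Walk.length_append, SimpleGraph.Walk.take_spec]
  exact hxy (SimpleGraph.Walk.eq_of_length_eq_zero (p := p.dropUntil y hy) (by omega))

/-- In a graph of large girth, the last edge of a short shortest walk is determined by its end. -/
lemma LocallyAcyclic.eq_of_walks [DecidableEq V] {m i : ℕ} {E : Finset (Sym2 V)}
    (h : LocallyAcyclic m E)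
    (hi : 2 * i + 2 ≤ m) {v x x' y : V}
    (hx : s(x, y) ∈ E) (hx' : s(x', y) ∈ E) (hxy : x ≠ y) (hxy' : x' ≠ y)
    (p : (SimpleGraph.fromEdgeSet (E : Set (Sym2 V))).Walk v x)
    (p' : (SimpleGraph.fromEdgeSet (E : Set (Sym2 V))).Walk v x')
    (hp : p.length ≤ i) (hp' : p'.length ≤ i) (hyp : y ∉ p.support) (hyp' : y ∉ p'.support) :
    x = x' := by
  -- The two walks and their last edges are at most `2 * i + 2 ≤ m` edges, so they form an acyclic
  -- graph in which `s(x, y)` is a bridge. Going from `x` back along `p`, then along `p'` to `x'`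
  -- and on to `y` avoids that bridge.
  by_contra hne
  set F : Finset (Sym2 V) := p.edges.toFinset ∪ p'.edges.toFinset ∪ {s(x, y), s(x', y)} with hF
  have hsub : ∀ {a b : V} (q : (SimpleGraph.fromEdgeSet (E : Set (Sym2 V))).Walk a b),
      q.edges.toFinset ⊆ E := by
    intro a b q e he
    have := q.edges_subset_edgeSet (List.mem_toFinset.1 he)
    rw [SimpleGraph.edgeSet_fromEdgeSet] at this
    exact_mod_cast this.1
  have hFE : F ⊆ E := by
    refine Finset.union_subset (Finset.union_subset (hsub p) (hsub p')) ?_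
    intro e he
    simp only [Finset.mem_insert, Finset.mem_singleton] at he
    rcases he with rfl | rfl <;> assumption
  have hcl : ∀ {a b : V} (q : (SimpleGraph.fromEdgeSet (E : Set (Sym2 V))).Walk a b),
      q.edges.toFinset.card ≤ q.length := by
    intro a b q
    rw [← SimpleGraph.Walk.length_edges]
    exact List.toFinset_card_le _
  have hcard : F.card ≤ m := by
    have h1 := Finset.card_union_le (p.edges.toFinset ∪ p'.edges.toFinset) {s(x, y), s(x', y)}
    have h2 := Finset.card_union_le p.edges.toFinset p'.edges.toFinset
    have h3 : ({s(x, y), s(x', y)} : Finset (Sym2 V)).card ≤ 2 := Finset.card_le_two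
    have h4 := hcl p
    have h5 := hcl p'
    rw [← hF] at h1
    omega
  have hac := h F hFE hcard
  rw [SimpleGraph.isAcyclic_iff_forall_adj_isBridge] at hac
  have hadj : (SimpleGraph.fromEdgeSet (F : Set (Sym2 V))).Adj x y := by
    simp [hF, hxy]
  have hbr := hac hadj
  rw [SimpleGraph.isBridge_iff] at hbr
  have htr : ∀ {a b : V} (q : (SimpleGraph.fromEdgeSet (E : Set (Sym2 V))).Walk a b),
      q.edges.toFinset ⊆ F → y ∉ q.support →
      ((SimpleGraph.fromEdgeSet (F : Set (Sym2 V))).deleteEdges {s(x, y)}).Reachable a b := by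
    intro a b q hq hy
    refine ⟨q.transfer _ fun e he => ?_⟩
    rw [SimpleGraph.edgeSet_deleteEdges, SimpleGraph.edgeSet_fromEdgeSet]
    refine ⟨⟨by exact_mod_cast hq (List.mem_toFinset.2 he), ?_⟩, ?_⟩
    · exact SimpleGraph.not_isDiag_of_mem_edgeSet _ (q.edges_subset_edgeSet he)
    · rintro rfl
      exact hy (q.snd_mem_support_of_mem_edges he)
  refine hbr ?_
  have h1 := htr p (by
    intro e he; simp only [hF, Finset.mem_union]; exact Or.inl (Or.inl he)) hyp
  have h2 := htr p' (by
    intro e he; simp only [hF, Finset.mem_union]; exact Or.inl (Or.inr he)) hyp'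
  refine (h1.symm.trans h2).trans (SimpleGraph.Adj.reachable ?_)
  rw [SimpleGraph.deleteEdges_adj]
  refine ⟨by simp [hF, hxy'], ?_⟩
  simp only [Set.mem_singleton_iff, Sym2.eq_iff, not_or, not_and]
  exact ⟨fun h => absurd h.symm hne, fun h => absurd h hxy'⟩

/-- The edges meeting a ball of radius `i` are at most as many as the vertices of the ball of radius
`i + 1`. -/
lemma LocallyAcyclic.card_incident_le [DecidableEq V] {m i : ℕ} {E : Finset (Sym2 V)}
    (h : LocallyAcyclic m E) (hE : ∀ e ∈ E, ¬ e.IsDiag)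
    (hi : 2 * i + 2 ≤ m) (v : V) (B B' : Finset V)
    (hB : ∀ y ∈ B, ∃ p : (SimpleGraph.fromEdgeSet (E : Set (Sym2 V))).Walk v y, p.length ≤ i)
    (hB' : ∀ y, (∃ p : (SimpleGraph.fromEdgeSet (E : Set (Sym2 V))).Walk v y, p.length ≤ i + 1) →
      y ∈ B') :
    (E.filter fun e => ∃ y ∈ B, y ∈ e).card ≤ B'.card := by
  set G := SimpleGraph.fromEdgeSet (E : Set (Sym2 V)) with hG
  -- Each edge is charged to its end `y` that is not closer to `v`. A shortest walk to the other end
  -- `x` avoids `y`, so `LocallyAcyclic.eq_of_walks` makes the charging injective.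
  have key : ∀ e ∈ E.filter (fun e => ∃ y ∈ B, y ∈ e), ∃ y x, e = s(x, y) ∧ x ≠ y ∧ y ∈ B' ∧
      ∃ p : G.Walk v x, p.length ≤ i ∧ y ∉ p.support := by
    intro e he
    obtain ⟨heE, z, hzB, hze⟩ := Finset.mem_filter.1 he
    obtain ⟨z', rfl⟩ := Sym2.mem_iff_exists.1 hze
    have hzz' : z ≠ z' := by
      rintro rfl; exact hE _ heE (by simp)
    have hadj : G.Adj z z' := by
      rw [hG, SimpleGraph.fromEdgeSet_adj]; exact ⟨by exact_mod_cast heE, hzz'⟩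
    obtain ⟨p, hp⟩ := hB z hzB
    have hrz : G.Reachable v z := ⟨p⟩
    have hrz' : G.Reachable v z' := hrz.trans hadj.reachable
    have hdz : G.dist v z ≤ i := (SimpleGraph.dist_le p).trans hp
    obtain ⟨q, hq⟩ := hrz.exists_walk_length_eq_dist
    obtain ⟨q', hq'⟩ := hrz'.exists_walk_length_eq_dist
    rcases le_total (G.dist v z) (G.dist v z') with hle | hle
    · refine ⟨z', z, rfl, hzz', hB' _ ⟨p.concat hadj, by simpa using hp⟩, q, by omega, ?_⟩
      refine notMem_support_of_length_le q hzz'.symm fun r => ?_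
      have := SimpleGraph.dist_le r
      omega
    · refine ⟨z, z', Sym2.eq_swap, hzz'.symm, hB' _ ⟨p, by omega⟩, q', by omega, ?_⟩
      refine notMem_support_of_length_le q' hzz' fun r => ?_
      have := SimpleGraph.dist_le r
      omega
  have : Nonempty V := ⟨v⟩
  choose! f g hfg hne hfB hwalk using key
  refine Finset.card_le_card_of_injOn f (fun e he => hfB e he) ?_
  intro e he e' he' hff
  obtain ⟨p, hp, hyp⟩ := hwalk e he
  obtain ⟨p', hp', hyp'⟩ := hwalk e' he'
  have heE := (Finset.mem_filter.1 he).1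
  have heE' := (Finset.mem_filter.1 he').1
  rw [hfg e he] at heE
  rw [hfg e' he'] at heE'
  rw [← hff] at hyp' heE'
  have hgg : g e = g e' := h.eq_of_walks hi heE heE' (hne e he) (by rw [hff]; exact hne e' he')
    p p' hp hp' hyp hyp'
  rw [hfg e he, hfg e' he', hgg, hff]

/-- The Moore bound: a graph on `X` without cycles of length at most `2 k` has at most
`|X| t` edges if `|X| ≤ t ^ k`. -/
theorem LocallyAcyclic.card_le [DecidableEq V] {k : ℕ} (hk : 1 ≤ k) {t : ℝ} (ht : 0 ≤ t)
    (X : Finset V)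
    (E : Finset (Sym2 V)) (h : LocallyAcyclic (2 * k) E) (hE : ∀ e ∈ E, ¬ e.IsDiag)
    (hX : ∀ e ∈ E, ∀ v ∈ e, v ∈ X) (hXt : (X.card : ℝ) ≤ t ^ k) :
    (E.card : ℝ) ≤ X.card * t := by
  classical
  induction hn : X.card using Nat.strong_induction_on generalizing X E with
  | _ N ih =>
  rcases X.eq_empty_or_nonempty with rfl | ⟨v, hv⟩
  · have : E = ∅ := by
      refine Finset.eq_empty_of_forall_notMem fun e he => ?_
      induction e with
      | _ a b => exact absurd (hX _ he a (by simp)) (by simp)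
    subst this
    simp only [Finset.card_empty] at hn ⊢
    simp [← hn]
  set G := SimpleGraph.fromEdgeSet (E : Set (Sym2 V)) with hG
  let B : ℕ → Finset V := fun i => X.filter fun y => ∃ p : G.Walk v y, p.length ≤ i
  have hwalkX : ∀ {a b : V} (p : G.Walk a b), a ∈ X → b ∈ X := by
    intro a b p ha
    induction p with
    | nil => exact ha
    | @cons a c b hac p ihp =>
      refine ihp ?_
      rw [hG, SimpleGraph.fromEdgeSet_adj] at hac
      exact hX _ (by exact_mod_cast hac.1) c (by simp)
  have hvB : ∀ i, v ∈ B i := fun i => by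
    simp only [B, Finset.mem_filter]
    exact ⟨hv, .nil, by simp⟩
  -- Balls cannot grow by a factor above `t` in all of the `k` steps, or the last one would exceed
  -- `t ^ k ≥ |X|`. At radius `0` only the weak inequality is available, whence the disjunction in
  -- `hpow`.
  obtain ⟨i, hik, hgrow⟩ : ∃ i < k, ((B (i + 1)).card : ℝ) ≤ t * (B i).card := by
    by_contra! hcon
    have hpow : ∀ i ≤ k, i = 0 ∨ t ^ i < ((B i).card : ℝ) := by
      intro i
      induction i with
      | zero => intro _; exact Or.inl rfl
      | succ i ihi =>
        intro hik
        right
        have h1 : t ^ i ≤ ((B i).card : ℝ) := by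
          rcases ihi (by omega) with rfl | h
          · have : 0 < (B 0).card := Finset.card_pos.2 ⟨v, hvB 0⟩
            simp only [pow_zero]
            exact_mod_cast this
          · exact h.le
        calc t ^ (i + 1) = t * t ^ i := pow_succ' _ _
          _ ≤ t * (B i).card := by gcongr
          _ < _ := hcon i (by omega)
    rcases hpow k le_rfl with rfl | hlt
    · omega
    · have := Finset.card_le_card (Finset.filter_subset _ _ : B k ⊆ X)
      have : ((B k).card : ℝ) ≤ X.card := by exact_mod_cast this
      linarith
  -- Deleting the slowly growing ball removes `(B i).card` vertices and at most `(B (i + 1)).card ≤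
  -- t * (B i).card` edges, so the bound follows by induction.
  set E' := E.filter fun e => ¬ ∃ y ∈ B i, y ∈ e with hE'
  have hBX : B i ⊆ X := Finset.filter_subset _ _
  have hcX : (X \ B i).card + (B i).card = X.card := Finset.card_sdiff_add_card_eq_card hBX
  have hBpos : 0 < (B i).card := Finset.card_pos.2 ⟨v, hvB i⟩
  have hih := ih (X \ B i).card (by omega) (X \ B i) E' (h.subset (Finset.filter_subset _ _))
    (fun e he => hE e (Finset.filter_subset _ _ he)) (by
      intro e he y hy
      obtain ⟨he1, he2⟩ := Finset.mem_filter.1 he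
      push Not at he2
      exact Finset.mem_sdiff.2 ⟨hX e he1 y hy, fun hyB => he2 y hyB hy⟩) (by
      refine le_trans ?_ hXt
      exact_mod_cast Finset.card_le_card Finset.sdiff_subset) rfl
  have hinc := h.card_incident_le (i := i) hE (by omega) v (B i) (B (i + 1)) (by
      intro y hy
      exact (Finset.mem_filter.1 hy).2) (by
      rintro y ⟨p, hp⟩
      exact Finset.mem_filter.2 ⟨hwalkX p hv, p, hp⟩)
  have hsum : (E.filter fun e => ∃ y ∈ B i, y ∈ e).card + E'.card = E.card :=
    Finset.card_filter_add_card_filter_not _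
  have h1 : (E.card : ℝ) ≤ (B (i + 1)).card + E'.card := by
    rw [← hsum]; push_cast; gcongr
  have h2 : (N : ℝ) = (X \ B i).card + (B i).card := by
    rw [← hn, ← hcX]; push_cast; rfl
  rw [h2]
  nlinarith

end Girth

/-! ### Weighted graphs formed by sets of tokens. -/

section Tokens

variable {V W : Type}

/-- The tokens announcing the edges of `G` with their weights. -/
def tokensOf (G : SimpleGraph V) (w : Sym2 V → W) : Set (Sym2 V × W) :=
  {x | x.1 ∈ G.edgeSet ∧ x.2 = w x.1}

lemma injOn_fst_tokensOf (G : SimpleGraph V) (w : Sym2 V → W) :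
    Set.InjOn Prod.fst (tokensOf G w) := by
  rintro ⟨e, ω⟩ h ⟨e', ω'⟩ h' (rfl : e = e')
  exact Prod.ext rfl (h.2.trans h'.2.symm)

lemma not_isDiag_of_mem_tokensOf {G : SimpleGraph V} {w : Sym2 V → W} {x : Sym2 V × W}
    (hx : x ∈ tokensOf G w) : ¬ x.1.IsDiag := G.not_isDiag_of_mem_edgeSet hx.1

lemma graphOf_le {G : SimpleGraph V} {w : Sym2 V → W} {A : Set (Sym2 V × W)}
    (hA : A ⊆ tokensOf G w) : graphOf A ≤ G := by
  intro u v h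
  obtain ⟨⟨x, hx, hxe⟩, -⟩ := graphOf_adj.1 h
  have := (hA hx).1
  rwa [hxe] at this

lemma exists_mem_of_mem_edgeSet_graphOf {A : Set (Sym2 V × W)} {e : Sym2 V}
    (he : e ∈ (graphOf A).edgeSet) : ∃ x ∈ A, x.1 = e := by
  rw [graphOf, SimpleGraph.edgeSet_fromEdgeSet] at he
  exact he.1

open Classical in
/-- The edge weights announced by a set of tokens. -/
noncomputable def weightOf (val : W → ℝ≥0) (A : Set (Sym2 V × W)) (e : Sym2 V) : ℝ≥0 :=
  if h : ∃ ω, (e, ω) ∈ A then val h.choose else 0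

/-- The algorithm sees only stored tokens, not `w`. In tokens of one graph every edge carries a
single word, so the choice in `weightOf` is harmless. -/
lemma weightOf_eq {val : W → ℝ≥0} {G : SimpleGraph V} {w : Sym2 V → W} {A : Set (Sym2 V × W)}
    (hA : A ⊆ tokensOf G w) {e : Sym2 V} (he : e ∈ (graphOf A).edgeSet) :
    weightOf val A e = val (w e) := by
  obtain ⟨⟨e', ω⟩, hx, rfl⟩ := exists_mem_of_mem_edgeSet_graphOf he
  have h : ∃ ω, (e', ω) ∈ A := ⟨ω, hx⟩
  simp only [weightOf, h, dite_true]
  exact congrArg val (hA h.choose_spec).2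

/-- The distance in the weighted graph formed by a set of tokens. -/
noncomputable def tokenDist (val : W → ℝ≥0) (A : Set (Sym2 V × W)) (s v : V) : ℝ≥0∞ :=
  wdist (graphOf A) (weightOf val A) s v

lemma tokenDist_eq {val : W → ℝ≥0} {G : SimpleGraph V} {w : Sym2 V → W} {A : Set (Sym2 V × W)}
    (hA : A ⊆ tokensOf G w) (s v : V) :
    tokenDist val A s v = wdist (graphOf A) (fun e => val (w e)) s v :=
  wdist_congr_weight fun _ he => weightOf_eq hA he

/-- The bottleneck connection can be taken to be a path: fewer than `n` edges, none heavier than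
`x`. -/
lemma wdist_le_card_mul_of_bottleneckConnected [Fintype V] {val : W → ℝ≥0} {G : SimpleGraph V}
    {w : Sym2 V → W} {F : Set (Sym2 V × W)} (hF : F ⊆ tokensOf G w) {x : Sym2 V × W}
    (hx : BottleneckConnected val F x) {u v : V} (huv : x.1 = s(u, v)) :
    wdist (graphOf F) (fun e => val (w e)) u v ≤ Fintype.card V * (val x.2 : ℝ≥0∞) := by
  obtain ⟨p, hp⟩ := (hx u v huv).exists_isPath
  have hle : graphOf {y | y ∈ F ∧ val y.2 ≤ val x.2} ≤ graphOf F := graphOf_mono fun y hy => hy.1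
  refine (wdist_mono hle).trans ((wdist_le_length_mul p (val x.2) ?_).trans ?_)
  · intro e he
    obtain ⟨y, ⟨hyF, hyx⟩, rfl⟩ := exists_mem_of_mem_edgeSet_graphOf (p.edges_subset_edgeSet he)
    rwa [← (hF hyF).2]
  · have := hp.length_lt.le
    gcongr

end Tokens

/-! ### The greedy spanner, scale by scale. -/

section Spanner

variable {V W : Type}

/-- The scale of the weight of a token. -/
noncomputable def scale (val : W → ℝ≥0) (x : Sym2 V × W) : ℤ := Int.log 2 (val x.2 : ℝ)

/-- The weight of the token is comparable to the values of `D` at both endpoints. -/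
def Comparable (val : W → ℝ≥0) (D : V → ℝ≥0∞) (m : ℕ) (x : Sym2 V × W) : Prop :=
  ∀ v ∈ x.1, (val x.2 : ℝ≥0∞) < D v ∧ D v ≤ 2 ^ m * (val x.2 : ℝ≥0∞)

/-- The tokens of `H` of scale `j`. -/
def atScale (val : W → ℝ≥0) (H : Set (Sym2 V × W)) (j : ℤ) : Set (Sym2 V × W) :=
  {y | y ∈ H ∧ scale val y = j}

/-- The greedy rule of the spanner: `x` is kept if its endpoints are not yet connected by fewer than
`2 k` edges of its scale. -/
def Keeps (val : W → ℝ≥0) (D : V → ℝ≥0∞) (m k : ℕ) (H : Set (Sym2 V × W)) (x : Sym2 V × W) : Prop :=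
  Comparable val D m x ∧ ∀ u v, x.1 = s(u, v) →
    ∀ p : (graphOf (atScale val H (scale val x))).Walk u v, 2 * k ≤ p.length

/-- The invariant of the greedy spanner `H` of the set `P` of tokens seen so far. -/
structure IsGreedySpanner [DecidableEq V] (val : W → ℝ≥0) (D : V → ℝ≥0∞) (m k : ℕ)
    (H : Finset (Sym2 V × W)) (P : Set (Sym2 V × W)) : Prop where
  subset : (H : Set (Sym2 V × W)) ⊆ P
  comparable : ∀ x ∈ H, Comparable val D m x
  locallyAcyclic : ∀ j, LocallyAcyclic (2 * k) ((H.filter fun x => scale val x = j).image Prod.fst)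
  walk : ∀ x ∈ P, Comparable val D m x → ∀ u v, x.1 = s(u, v) →
    ∃ p : (graphOf (atScale val (H : Set (Sym2 V × W)) (scale val x))).Walk u v, p.length < 2 * k

variable {val : W → ℝ≥0} {D : V → ℝ≥0∞} {m k : ℕ}

lemma coe_filter_scale {H : Finset (Sym2 V × W)} (j : ℤ) :
    ((H.filter fun x => scale val x = j : Finset _) : Set (Sym2 V × W)) =
      atScale val (H : Set (Sym2 V × W)) j := by
  ext; simp [atScale]

lemma isGreedySpanner_empty [DecidableEq V] : IsGreedySpanner val D m k ∅ ∅ where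
  subset := by simp
  comparable := by simp
  locallyAcyclic j := by
    intro F hF _
    have : F = ∅ := by simpa using hF
    simp [this]
  walk := by simp

lemma IsGreedySpanner.insert_of_not_keeps [DecidableEq V]
    {H : Finset (Sym2 V × W)} {P : Set (Sym2 V × W)} {x : Sym2 V × W}
    (h : IsGreedySpanner val D m k H P) (hx : ¬ Keeps val D m k (H : Set (Sym2 V × W)) x) :
    IsGreedySpanner val D m k H (insert x P) where
  subset := h.subset.trans (Set.subset_insert _ _)
  comparable := h.comparable
  locallyAcyclic := h.locallyAcyclic
  walk := by
    intro y hy hc u v huv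
    rcases hy with rfl | hy
    · simp only [Keeps, not_and, not_forall, not_le] at hx
      obtain ⟨a, b, hab, p, hp⟩ := hx hc
      rcases Sym2.eq_iff.1 (hab.symm.trans huv) with ⟨rfl, rfl⟩ | ⟨rfl, rfl⟩
      · exact ⟨p, hp⟩
      · exact ⟨p.reverse, by simpa using hp⟩
    · exact h.walk y hy hc u v huv

/-- The kept token closes no cycle of at most `2 * k` edges at its own scale
(`locallyAcyclic_insert`) and leaves the other scales untouched. -/
lemma IsGreedySpanner.insert_of_keeps [DecidableEq V] [DecidableEq W] (hk : 1 ≤ k)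
    {H : Finset (Sym2 V × W)} {P : Set (Sym2 V × W)} {x : Sym2 V × W}
    (h : IsGreedySpanner val D m k H P) (hx : Keeps val D m k (H : Set (Sym2 V × W)) x) :
    IsGreedySpanner val D m k (insert x H) (insert x P) where
  subset := by
    rw [Finset.coe_insert]
    exact Set.insert_subset_insert h.subset
  comparable := by
    intro y hy
    rcases Finset.mem_insert.1 hy with rfl | hy
    · exact hx.1
    · exact h.comparable y hy
  locallyAcyclic := by
    intro j
    rw [Finset.filter_insert]
    split_ifs with hj
    · rw [Finset.image_insert]
      obtain ⟨⟨u, v⟩, ω⟩ := x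
      refine locallyAcyclic_insert (h.locallyAcyclic j) fun p => ?_
      have hg : SimpleGraph.fromEdgeSet
          ((((H.filter fun x => scale val x = j).image Prod.fst : Finset _)) : Set (Sym2 V)) =
          graphOf (atScale val (H : Set (Sym2 V × W)) j) := by
        rw [Finset.coe_image, coe_filter_scale]; rfl
      subst hj
      have := hx.2 u v rfl (p.mapLe hg.le)
      simpa using this
    · exact h.locallyAcyclic j
  walk := by
    have hsub : ∀ j, graphOf (atScale val (H : Set (Sym2 V × W)) j) ≤
        graphOf (atScale val ((insert x H : Finset _) : Set (Sym2 V × W)) j) := fun j =>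
      graphOf_mono fun y hy => ⟨by simpa using Or.inr hy.1, hy.2⟩
    intro y hy hc u v huv
    rcases hy with rfl | hy
    · by_cases huv' : u = v
      · subst huv'
        exact ⟨.nil, by simp; omega⟩
      · have : (graphOf (atScale val ((insert y H : Finset _) : Set (Sym2 V × W))
            (scale val y))).Adj u v := graphOf_adj.2 ⟨⟨y, ⟨by simp, rfl⟩, huv⟩, huv'⟩
        exact ⟨.cons this .nil, by simp; omega⟩
    · obtain ⟨p, hp⟩ := h.walk y hy hc u v huv
      exact ⟨p.mapLe (hsub _), by simpa using hp⟩

/-- The scales of weights comparable to `D v` lie in an interval. -/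
lemma scale_mem_Icc {x : Sym2 V × W} {v : V} (h : Comparable val D m x) (hv : v ∈ x.1) :
    scale val x ∈ Finset.Icc (Int.log 2 (D v).toReal - m) (Int.log 2 (D v).toReal) := by
  obtain ⟨h1, h2⟩ := h v hv
  have hfin : D v ≠ ⊤ := ne_top_of_le_ne_top (by finiteness) h2
  have h1' : (val x.2 : ℝ) < (D v).toReal := by
    have := (ENNReal.toReal_lt_toReal ENNReal.coe_ne_top hfin).2 h1
    simpa using this
  have h2' : (D v).toReal ≤ 2 ^ m * (val x.2 : ℝ) := by
    have := (ENNReal.toReal_le_toReal hfin (by finiteness)).2 h2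
    simpa using this
  have hD : 0 < (D v).toReal := (val x.2).2.trans_lt h1'
  have hpos : 0 < (val x.2 : ℝ) := by
    by_contra hcon
    have : (2 : ℝ) ^ m * (val x.2 : ℝ) ≤ 0 :=
      mul_nonpos_of_nonneg_of_nonpos (by positivity) (not_lt.1 hcon)
    linarith
  rw [Finset.mem_Icc]
  constructor
  -- The `+ 1` from rounding down is absorbed by the strict inequality, so the interval has exactly
  -- `m + 1` integers.
  · have h3 : (D v).toReal < ((2 : ℕ) : ℝ) ^ ((m : ℤ) + (Int.log 2 (val x.2 : ℝ) + 1)) := by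
      rw [zpow_add₀ (by norm_num), zpow_natCast]
      refine h2'.trans_lt ?_
      have := Int.lt_zpow_succ_log_self (R := ℝ) (b := 2) (by norm_num) (val x.2 : ℝ)
      push_cast at this ⊢
      gcongr
    have h4 := (Int.lt_zpow_iff_log_lt (by norm_num) hD).1 h3
    simp only [scale]
    omega
  · exact Int.log_mono_right hpos h1'.le

/-- The size of the greedy spanner. -/
theorem IsGreedySpanner.card_le [DecidableEq V] [DecidableEq W] [Fintype V] (hk : 1 ≤ k) {t : ℝ}
    (ht : 0 ≤ t)
    (hVt : (Fintype.card V : ℝ) ≤ t ^ k) {G : SimpleGraph V} {w : Sym2 V → W}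
    {H : Finset (Sym2 V × W)} {P : Set (Sym2 V × W)} (h : IsGreedySpanner val D m k H P)
    (hP : P ⊆ tokensOf G w) :
    (H.card : ℝ) ≤ Fintype.card V * (m + 1) * t := by
  classical
  set J := H.image (scale val) with hJ
  let E : ℤ → Finset (Sym2 V) := fun j => (H.filter fun x => scale val x = j).image Prod.fst
  -- The Moore bound is applied at scale `j` only to the vertices touched there. Each vertex is
  -- touched at no more than `m + 1` scales, so the sum does not depend on how many scales occur
  -- overall.
  let X : ℤ → Finset V := fun j => Finset.univ.filter fun v => ∃ e ∈ E j, v ∈ e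
  have hcard : H.card = ∑ j ∈ J, (E j).card := by
    rw [Finset.card_eq_sum_card_image (scale val) H]
    refine Finset.sum_congr rfl fun j _ => ?_
    rw [Finset.card_image_of_injOn]
    refine (injOn_fst_tokensOf G w).mono fun x hx => hP (h.subset ?_)
    exact (Finset.mem_filter.1 hx).1
  have hj : ∀ j, ((E j).card : ℝ) ≤ (X j).card * t := by
    intro j
    refine (h.locallyAcyclic j).card_le hk ht (X j) (E j) ?_ ?_ ?_
    · intro e he
      obtain ⟨x, hx, rfl⟩ := Finset.mem_image.1 he
      exact not_isDiag_of_mem_tokensOf (hP (h.subset (Finset.mem_filter.1 hx).1))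
    · intro e he v hv
      simp only [X, Finset.mem_filter, Finset.mem_univ, true_and]
      exact ⟨e, he, hv⟩
    · refine le_trans ?_ hVt
      exact_mod_cast Finset.card_le_univ _
  have hswap : ∑ j ∈ J, (X j).card = ∑ v : V, (J.filter fun j => v ∈ X j).card := by
    have := Finset.sum_card_bipartiteAbove_eq_sum_card_bipartiteBelow
      (s := J) (t := (Finset.univ : Finset V)) (fun j v => v ∈ X j)
    simpa [Finset.bipartiteAbove, Finset.bipartiteBelow] using this
  have hv : ∀ v : V, (J.filter fun j => v ∈ X j).card ≤ m + 1 := by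
    intro v
    have hsub : (J.filter fun j => v ∈ X j) ⊆
        Finset.Icc (Int.log 2 (D v).toReal - m) (Int.log 2 (D v).toReal) := by
      intro j hj
      obtain ⟨-, hjX⟩ := Finset.mem_filter.1 hj
      simp only [X, Finset.mem_filter, Finset.mem_univ, true_and] at hjX
      obtain ⟨e, he, hve⟩ := hjX
      obtain ⟨x, hx, rfl⟩ := Finset.mem_image.1 he
      obtain ⟨hxH, rfl⟩ := Finset.mem_filter.1 hx
      exact scale_mem_Icc (h.comparable x hxH) hve
    refine (Finset.card_le_card hsub).trans ?_
    rw [Int.card_Icc]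
    omega
  have htot : ∑ j ∈ J, (X j).card ≤ Fintype.card V * (m + 1) := by
    rw [hswap]
    refine (Finset.sum_le_sum fun v _ => hv v).trans ?_
    simp
  calc (H.card : ℝ) = ∑ j ∈ J, ((E j).card : ℝ) := by rw [hcard]; push_cast; rfl
    _ ≤ ∑ j ∈ J, ((X j).card : ℝ) * t := Finset.sum_le_sum fun j _ => hj j
    _ = ((∑ j ∈ J, (X j).card : ℕ) : ℝ) * t := by rw [← Finset.sum_mul]; push_cast; rfl
    _ ≤ ((Fintype.card V * (m + 1) : ℕ) : ℝ) * t := by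
        gcongr
    _ = _ := by push_cast; rfl

/-- The stretch of the greedy spanner. -/
theorem IsGreedySpanner.wdist_le [DecidableEq V] {G : SimpleGraph V}
    {w : Sym2 V → W} {H : Finset (Sym2 V × W)} {P : Set (Sym2 V × W)}
    (h : IsGreedySpanner val D m k H P) (hP : P ⊆ tokensOf G w) {x : Sym2 V × W} (hx : x ∈ P)
    (hc : Comparable val D m x) {u v : V} (huv : x.1 = s(u, v)) :
    wdist (graphOf (H : Set (Sym2 V × W))) (fun e => val (w e)) u v ≤ 4 * k * (val x.2 : ℝ≥0∞) := by
  obtain ⟨p, hp⟩ := h.walk x hx hc u v huv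
  -- Zero weights are excluded: they would give `0 < D a ≤ 2 ^ m * 0`. Positivity is needed to bound
  -- a weight below by the power of two of its scale.
  have hpos : ∀ y, Comparable val D m y → 0 < (val y.2 : ℝ) := by
    intro y hy
    induction hy1 : y.1 with
    | _ a b =>
    obtain ⟨h1, h2⟩ := hy a (by simp [hy1])
    rcases eq_or_ne (val y.2) 0 with h0 | h0
    · simp [h0] at h1 h2
      exact absurd h2 h1.ne'
    · exact_mod_cast pos_iff_ne_zero.2 h0
  have hle : graphOf (atScale val (H : Set (Sym2 V × W)) (scale val x)) ≤
      graphOf (H : Set (Sym2 V × W)) := graphOf_mono fun y hy => hy.1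
  -- Weights of one scale differ by less than a factor of two; with fewer than `2 * k` edges this
  -- gives stretch `4 * k`.
  refine (wdist_mono hle).trans ((wdist_le_length_mul p (2 * val x.2) ?_).trans ?_)
  · intro e he
    obtain ⟨y, ⟨hyH, hyx⟩, rfl⟩ := exists_mem_of_mem_edgeSet_graphOf (p.edges_subset_edgeSet he)
    rw [← (hP (h.subset hyH)).2]
    have h1 := Int.lt_zpow_succ_log_self (R := ℝ) (b := 2) (by norm_num) (val y.2 : ℝ)
    have h2 := Int.zpow_log_le_self (R := ℝ) (b := 2) (by norm_num) (hpos x hc)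
    have h3 : Int.log 2 (val y.2 : ℝ) = Int.log 2 (val x.2 : ℝ) := hyx
    rw [h3, zpow_add₀ (by norm_num)] at h1
    have : (val y.2 : ℝ) ≤ 2 * val x.2 := by
      push_cast at h1 h2
      simp only [zpow_one] at h1
      linarith
    exact_mod_cast this
  · have : (p.length : ℝ≥0∞) ≤ 2 * k := by exact_mod_cast hp.le
    calc (p.length : ℝ≥0∞) * ((2 * val x.2 : ℝ≥0) : ℝ≥0∞)
        ≤ (2 * k) * ((2 * val x.2 : ℝ≥0) : ℝ≥0∞) := by
          gcongr
      _ = _ := by push_cast; ring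

end Spanner

/-! ### Hooks: edges from near the root to vertices farther than their weight. -/

section Hooks

variable {V W : Type} {val : W → ℝ≥0} {D : V → ℝ≥0∞} {m k : ℕ}

/-- The token `x` joins `v` to a vertex where `D` is at most the weight of `x`, while `D v` is
larger, but not by more than a factor of `2 ^ m`. -/
def HooksAt (val : W → ℝ≥0) (D : V → ℝ≥0∞) (m : ℕ) (x : Sym2 V × W) (v : V) : Prop :=
  ∃ u, x.1 = s(u, v) ∧ D u ≤ val x.2 ∧ (val x.2 : ℝ≥0∞) < D v ∧ D v ≤ 2 ^ m * (val x.2 : ℝ≥0∞)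

/-- The greedy rule for hooks: one per vertex and scale. -/
def IsNewHook (val : W → ℝ≥0) (D : V → ℝ≥0∞) (m : ℕ) (L : Set (Sym2 V × W)) (x : Sym2 V × W) :
    Prop :=
  ∃ v, HooksAt val D m x v ∧ ∀ y ∈ L, HooksAt val D m y v → scale val y ≠ scale val x

/-- `L` holds exactly one hook of `P` for every vertex and scale that has one. -/
structure IsHookSet (val : W → ℝ≥0) (D : V → ℝ≥0∞) (m : ℕ) (L : Finset (Sym2 V × W))
    (P : Set (Sym2 V × W)) : Prop where
  subset : (L : Set (Sym2 V × W)) ⊆ P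
  hook : ∀ x ∈ L, ∃ v, HooksAt val D m x v
  unique : ∀ x ∈ L, ∀ y ∈ L, ∀ v, HooksAt val D m x v → HooksAt val D m y v →
    scale val x = scale val y → x = y
  exists_hook : ∀ x ∈ P, ∀ v, HooksAt val D m x v →
    ∃ y ∈ L, HooksAt val D m y v ∧ scale val y = scale val x

/-- A token cannot hook at both ends: `D` would be both at most and above its weight at the same
vertex. -/
lemma HooksAt.eq {x : Sym2 V × W} {v v' : V} (h : HooksAt val D m x v)
    (h' : HooksAt val D m x v') : v = v' := by
  obtain ⟨u, hu, h1, h2, -⟩ := h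
  obtain ⟨u', hu', h1', h2', -⟩ := h'
  rcases Sym2.eq_iff.1 (hu.symm.trans hu') with ⟨rfl, rfl⟩ | ⟨rfl, rfl⟩
  · rfl
  · exact absurd h1 (not_le.2 h2')

lemma isHookSet_empty : IsHookSet val D m ∅ ∅ where
  subset := by simp
  hook := by simp
  unique := by simp
  exists_hook := by simp

lemma IsHookSet.insert_of_not_isNewHook {L : Finset (Sym2 V × W)} {P : Set (Sym2 V × W)}
    {x : Sym2 V × W} (h : IsHookSet val D m L P)
    (hx : ¬ IsNewHook val D m (L : Set (Sym2 V × W)) x) :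
    IsHookSet val D m L (insert x P) where
  subset := h.subset.trans (Set.subset_insert _ _)
  hook := h.hook
  unique := h.unique
  exists_hook := by
    intro y hy v hv
    rcases hy with rfl | hy
    · simp only [IsNewHook, not_exists, not_and, not_forall, not_not] at hx
      obtain ⟨y, hy, hyv, hs⟩ := hx v hv
      exact ⟨y, hy, hyv, hs⟩
    · exact h.exists_hook y hy v hv

lemma IsHookSet.insert_of_isNewHook [DecidableEq V] [DecidableEq W]
    {L : Finset (Sym2 V × W)} {P : Set (Sym2 V × W)}
    {x : Sym2 V × W} (h : IsHookSet val D m L P) (hx : IsNewHook val D m (L : Set (Sym2 V × W)) x) :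
    IsHookSet val D m (insert x L) (insert x P) where
  subset := by
    rw [Finset.coe_insert]
    exact Set.insert_subset_insert h.subset
  hook := by
    intro y hy
    rcases Finset.mem_insert.1 hy with rfl | hy
    · exact ⟨hx.choose, hx.choose_spec.1⟩
    · exact h.hook y hy
  unique := by
    obtain ⟨v₀, hv₀, hnew⟩ := hx
    intro y hy z hz v hyv hzv hyz
    rcases Finset.mem_insert.1 hy with rfl | hy <;> rcases Finset.mem_insert.1 hz with rfl | hz
    · rfl
    · obtain rfl := hv₀.eq hyv
      exact absurd hyz.symm (hnew z hz hzv)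
    · obtain rfl := hv₀.eq hzv
      exact absurd hyz (hnew y (by assumption) hyv)
    · exact h.unique y hy z hz v hyv hzv hyz
  exists_hook := by
    intro y hy v hv
    rcases hy with rfl | hy
    · exact ⟨y, Finset.mem_insert_self _ _, hv, rfl⟩
    · obtain ⟨z, hz, hzv, hs⟩ := h.exists_hook y hy v hv
      exact ⟨z, Finset.mem_insert_of_mem hz, hzv, hs⟩

/-- A hook satisfies the range condition at one end only, so `scale_mem_Icc` is applied to a dummy
one-vertex token. -/
lemma log_mem_Icc {a : ℝ≥0} {d : ℝ≥0∞} (h1 : (a : ℝ≥0∞) < d) (h2 : d ≤ 2 ^ m * (a : ℝ≥0∞)) :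
    Int.log 2 (a : ℝ) ∈ Finset.Icc (Int.log 2 d.toReal - m) (Int.log 2 d.toReal) := by
  let x : Sym2 Unit × Unit := (s((), ()), ())
  exact scale_mem_Icc (val := fun _ => a) (D := fun _ => d) (m := m) (x := x) (v := ())
    (fun _ _ => ⟨h1, h2⟩) (by simp [x])

theorem IsHookSet.card_le [Fintype V] {L : Finset (Sym2 V × W)}
    {P : Set (Sym2 V × W)} (h : IsHookSet val D m L P) : L.card ≤ Fintype.card V * (m + 1) := by
  classical
  let B : Finset (Σ _ : V, ℤ) := Finset.univ.sigma fun v =>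
    Finset.Icc (Int.log 2 (D v).toReal - m) (Int.log 2 (D v).toReal)
  have hB : B.card = Fintype.card V * (m + 1) := by
    rw [Finset.card_sigma]
    simp only [Int.card_Icc]
    rw [Finset.sum_congr rfl (fun v _ => show _ = m + 1 by omega)]
    simp
  rcases L.eq_empty_or_nonempty with rfl | ⟨x₀, hx₀⟩
  · simp
  have : Nonempty V := ⟨(h.hook x₀ hx₀).choose⟩
  have hh := h.hook
  choose! f hf using hh
  rw [← hB]
  refine Finset.card_le_card_of_injOn (fun x => ⟨f x, scale val x⟩) ?_ ?_
  · intro x hx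
    obtain ⟨u, -, -, h1, h2⟩ := hf x hx
    rw [Finset.mem_coe, Finset.mem_sigma]
    exact ⟨Finset.mem_univ _, log_mem_Icc h1 h2⟩
  · intro x hx y hy hxy
    simp only [Sigma.mk.injEq, heq_eq_eq] at hxy
    refine h.unique x hx y hy (f x) (hf x hx) ?_ hxy.2
    rw [hxy.1]
    exact hf y hy

/-- The stretch of a hook. -/
theorem IsHookSet.le_four_mul {L : Finset (Sym2 V × W)} {P : Set (Sym2 V × W)}
    (h : IsHookSet val D m L P) {x : Sym2 V × W} (hx : x ∈ P) {v : V}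
    (hv : HooksAt val D m x v) (d : V → ℝ≥0∞) (hdD : ∀ v, d v ≤ D v)
    (hd : ∀ y ∈ L, ∀ a b, y.1 = s(a, b) → d b ≤ d a + val y.2) : d v ≤ 4 * (val x.2 : ℝ≥0∞) := by
  obtain ⟨y, hy, ⟨a, hab, ha, hv1, hv2⟩, hs⟩ := h.exists_hook x hx v hv
  obtain ⟨u, -, -, hv1', hv2'⟩ := hv
  have hpos : 0 < (val x.2 : ℝ) := by
    rcases eq_or_ne (val x.2) 0 with h0 | h0
    · simp [h0] at hv1' hv2'
      exact absurd hv2' hv1'.ne'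
    · exact_mod_cast pos_iff_ne_zero.2 h0
  have h1 := Int.lt_zpow_succ_log_self (R := ℝ) (b := 2) (by norm_num) (val y.2 : ℝ)
  have h2 := Int.zpow_log_le_self (R := ℝ) (b := 2) (by norm_num) hpos
  have h3 : Int.log 2 (val y.2 : ℝ) = Int.log 2 (val x.2 : ℝ) := hs
  rw [h3, zpow_add₀ (by norm_num)] at h1
  have h4 : (val y.2 : ℝ) ≤ 2 * val x.2 := by
    push_cast at h1 h2
    simp only [zpow_one] at h1
    linarith
  have h5 : (val y.2 : ℝ≥0∞) ≤ 2 * val x.2 := by exact_mod_cast h4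
  -- The stored hook may start at another vertex `a` than `x` does. Only `d a ≤ D a ≤ val y.2`
  -- matters, so the bound does not involve the other end of `x`.
  calc d v ≤ d a + val y.2 := hd y hy a v hab
    _ ≤ val y.2 + val y.2 := by gcongr; exact (hdD a).trans ha
    _ ≤ 2 * val x.2 + 2 * val x.2 := by gcongr
    _ = 4 * (val x.2 : ℝ≥0∞) := by rw [← add_mul]; norm_num

end Hooks

/-! ### Averaging the tree distances. -/

section Averaging

variable {V : Type} [Fintype V] {ι : Type} [Fintype ι] [Nonempty ι]

open Classical in
/-- If every edge is violated by few of the distance functions `d i`, then some `d i z` is close to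
the distance of `z`. -/
theorem exists_le_one_add_mul_wdist (G : SimpleGraph V) (w : Sym2 V → ℝ≥0) (s : V)
    (d : ι → V → ℝ≥0∞) (D : V → ℝ≥0∞) (m k : ℕ) (ε : ℝ≥0)
    (hs : ∀ i, d i s = 0) (hdD : ∀ i v, d i v ≤ D v)
    (hD : ∀ v, D v ≤ Fintype.card V * wdist G w s v)
    (hlight : ∀ i u v, G.Adj u v → d i v ≤ d i u + Fintype.card V * (w s(u, v) : ℝ≥0∞))
    (hmiddle : ∀ i u v, G.Adj u v → (w s(u, v) : ℝ≥0∞) < D v →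
      D v ≤ 2 ^ m * (w s(u, v) : ℝ≥0∞) → D u ≤ 2 ^ m * (w s(u, v) : ℝ≥0∞) →
      d i v ≤ d i u + 4 * k * (w s(u, v) : ℝ≥0∞))
    (hviol : ∀ u v, G.Adj u v →
      (Finset.univ.filter fun i => ¬ d i v ≤ d i u + w s(u, v)).card ≤ 3 * k)
    (hR : (24 * k ^ 2 : ℝ≥0) ≤ ε * Fintype.card ι)
    (hm : (2 * (Fintype.card V) ^ 3 : ℝ≥0) ≤ ε * 2 ^ m) (z : V) :
    ∃ i, d i z ≤ (1 + ε) * wdist G w s z := by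
  set n := Fintype.card V with hn
  set R := Fintype.card ι with hRdef
  have hn0 : 0 < n := Fintype.card_pos_iff.2 ⟨s⟩
  have hR0 : 0 < R := Fintype.card_pos
  let S : V → ℝ≥0∞ := fun v => ∑ i, d i v
  -- `M` stands for the length of the whole walk. The fixed charge `ε * M / (2 * n)` per edge and
  -- tree pays for light edges; at most `n` such charges add up to `ε * M / 2`, and the factor `1 +
  -- ε / 2` pays for violations.
  have hstep : ∀ (M : ℝ≥0) (u v : V), G.Adj u v → D u ≤ n * M → D v ≤ n * M →
      S v ≤ S u + ((R * (1 + ε / 2) * w s(u, v) + R * (ε * M / (2 * n)) : ℝ≥0) : ℝ≥0∞) := by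
    intro M u v huv hu hv
    set ω := w s(u, v) with hω
    have hconst : ∀ c : ℝ≥0, (∀ i, d i v ≤ d i u + c) → S v ≤ S u + ((R * c : ℝ≥0) : ℝ≥0∞) := by
      intro c hc
      refine (Finset.sum_le_sum fun i _ => hc i).trans ?_
      rw [Finset.sum_add_distrib]
      simp [S, R]
    have hlow : ∀ c : ℝ≥0, c ≤ R * (1 + ε / 2) * ω + R * (ε * M / (2 * n)) →
        S v ≤ S u + (c : ℝ≥0∞) →
        S v ≤ S u + ((R * (1 + ε / 2) * ω + R * (ε * M / (2 * n)) : ℝ≥0) : ℝ≥0∞) := by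
      intro c hc h
      refine h.trans ?_
      gcongr
    have hωle : (R : ℝ≥0) * ω ≤ R * (1 + ε / 2) * ω := by
      gcongr
      exact le_mul_of_one_le_right (by positivity) (le_add_of_nonneg_right (by positivity))
    by_cases hheavy : D v ≤ ω
    · refine hlow (R * ω) (hωle.trans (le_add_of_nonneg_right (by positivity)))
        (hconst _ fun i => ((hdD i v).trans hheavy).trans le_add_self)
    rw [not_le] at hheavy
    -- For a light edge the forest detour `n * ω` is at most `n ^ 2 * M / 2 ^ m`, which `hm` bounds
    -- by the fixed charge.
    by_cases hl : (2 : ℝ≥0∞) ^ m * ω ≤ n * M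
    · refine hlow (R * (n * ω)) ?_ (hconst _ fun i => by simpa using hlight i u v huv)
      refine le_trans ?_ le_add_self
      gcongr
      have hl' : (2 : ℝ≥0) ^ m * ω ≤ n * M := by exact_mod_cast hl
      rw [le_div_iff₀ (by positivity)]
      have h1 : (n : ℝ≥0) * (n * ω * (2 * n)) ≤ n * (ε * M) := by
        calc (n : ℝ≥0) * (n * ω * (2 * n)) = (2 * n ^ 3) * ω := by ring
          _ ≤ (ε * 2 ^ m) * ω := by gcongr
          _ = ε * (2 ^ m * ω) := by ring
          _ ≤ ε * (n * M) := by gcongr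
          _ = n * (ε * M) := by ring
      exact le_of_mul_le_mul_left h1 (by positivity)
    · rw [not_le] at hl
      have hu' := hu.trans hl.le
      have hv' := hv.trans hl.le
      -- All trees pay `ω`, and the at most `3 * k` violated ones an extra `4 * k * ω`; `hR` bounds
      -- the total extra `12 * k ^ 2 * ω` by `ε / 2 * R * ω`.
      refine hlow (R * ω + 3 * k * (4 * k * ω)) ?_ ?_
      · refine le_trans ?_ (le_add_of_nonneg_right (by positivity))
        have : (3 * k * (4 * k * ω) : ℝ≥0) ≤ ε / 2 * R * ω := by
          calc (3 * k * (4 * k * ω) : ℝ≥0) = (24 * k ^ 2) / 2 * ω := by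
                rw [show (24 * k ^ 2 : ℝ≥0) = 2 * (12 * k ^ 2) by ring,
                  mul_div_cancel_left₀ _ two_ne_zero]; ring
            _ ≤ (ε * R) / 2 * ω := by gcongr
            _ = _ := by ring
        calc (R * ω + 3 * k * (4 * k * ω) : ℝ≥0) ≤ R * ω + ε / 2 * R * ω := by gcongr
          _ = _ := by ring
      · calc S v ≤ ∑ i, (d i u + ω + if ¬ d i v ≤ d i u + ω then 4 * k * (ω : ℝ≥0∞) else 0) := by
              refine Finset.sum_le_sum fun i _ => ?_
              split_ifs with h
              · simpa using h
              · refine (hmiddle i u v huv hheavy hv' hu').trans ?_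
                rw [add_right_comm]
                exact le_self_add
          _ = S u + R * ω + (Finset.univ.filter fun i => ¬ d i v ≤ d i u + ω).card *
                (4 * k * (ω : ℝ≥0∞)) := by
              rw [Finset.sum_add_distrib, Finset.sum_add_distrib, ← Finset.sum_filter]
              simp [S, R]
          _ ≤ S u + R * ω + ((3 * k : ℕ) : ℝ≥0∞) * (4 * k * (ω : ℝ≥0∞)) := by
              gcongr
              exact hviol u v huv
          _ = _ := by push_cast; ring
  have hwalk : ∀ (M : ℝ≥0) (u v : V) (p : G.Walk u v), (∀ x ∈ p.support, D x ≤ n * M) →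
      S v ≤ S u + ((R * (1 + ε / 2) * (p.edges.map w).sum +
        p.length * (R * (ε * M / (2 * n))) : ℝ≥0) : ℝ≥0∞) := by
    intro M u v p hp
    induction p with
    | nil => simp
    | @cons a b c hab p ih =>
      refine (ih fun x hx => hp x (by simp [hx])).trans ?_
      refine (add_le_add_left (hstep M a b hab (hp a (by simp)) (hp b (by simp))) _).trans ?_
      rw [add_assoc, ← ENNReal.coe_add]
      refine add_le_add_right (ENNReal.coe_le_coe.2 (le_of_eq ?_)) _
      simp only [SimpleGraph.Walk.edges_cons, List.map_cons, List.sum_cons,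
        SimpleGraph.Walk.length_cons]
      push_cast
      ring
  have hpath : ∀ p : G.Walk s z,
      S z ≤ R * ((1 + ε) * (((p.edges.map w).sum : ℝ≥0) : ℝ≥0∞)) := by
    intro p
    set M := (p.edges.map w).sum with hM
    -- Passing to a path bounds the number of edges by `n`; each prefix has length at most `M`,
    -- which gives `D ≤ n * M` along it.
    set q := p.bypass with hq
    have hqM : (q.edges.map w).sum ≤ M :=
      ((p.edges_bypass_sublist_edges.map w).sum_le_sum (by simp))
    have hDM : ∀ x ∈ q.support, D x ≤ n * M := by
      intro x hx
      refine (hD x).trans ?_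
      gcongr
      refine (wdist_le_walk (q.takeUntil x hx)).trans (ENNReal.coe_le_coe.2 ?_)
      refine le_trans ?_ hqM
      exact (((q.isSubwalk_takeUntil hx).edges_isInfix.sublist.map w).sum_le_sum (by simp))
    have hlen : q.length ≤ n := (p.bypass_isPath.length_lt).le
    have hSs : S s = 0 := by simp [S, hs]
    refine (hwalk M s z q hDM).trans ?_
    rw [hSs, zero_add]
    have : (R * (1 + ε / 2) * (q.edges.map w).sum + q.length * (R * (ε * M / (2 * n))) : ℝ≥0) ≤
        R * ((1 + ε) * M) := by
      calc (R * (1 + ε / 2) * (q.edges.map w).sum + q.length * (R * (ε * M / (2 * n))) : ℝ≥0)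
          ≤ R * (1 + ε / 2) * M + n * (R * (ε * M / (2 * n))) := by
            gcongr
        _ = R * ((1 + ε) * M) := by
            have : (n : ℝ≥0) ≠ 0 := by positivity
            field_simp
            ring
    exact_mod_cast this
  obtain ⟨i, -, hi⟩ := Finset.exists_min_image Finset.univ (fun i => d i z) Finset.univ_nonempty
  refine ⟨i, ?_⟩
  have hRi : R * d i z ≤ S z := by
    have := Finset.card_nsmul_le_sum Finset.univ (fun i => d i z) (d i z) hi
    simpa [S, R] using this
  unfold wdist
  rw [ENNReal.mul_iInf_of_ne (by positivity) (by finiteness)]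
  refine le_iInf fun p => ?_
  have := hRi.trans (hpath p)
  rwa [ENNReal.mul_le_mul_iff_right (by positivity) (by finiteness)] at this

end Averaging

/-! ### From abstract finite memories to words, and probability bounds for runs. -/

section Machine

variable {M Tok Out : Type}

/-- One pass of an algorithm with an abstract set of memory states. -/
noncomputable def passRun (step : M → Tok → PMF M) (endPass : M → PMF M) : List Tok → M → PMF M
  | [], m => endPass m
  | e :: σ, m => (step m e).bind (passRun step endPass σ)

/-- Several passes of an algorithm with an abstract set of memory states. -/
noncomputable def multiRun (init : M) (pass : M → PMF M) : ℕ → PMF M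
  | 0 => PMF.pure init
  | p + 1 => (multiRun init pass p).bind pass

/-- A finite memory can be stored in words. -/
theorem exists_streamingAlgorithm [Finite M] {b S : ℕ} (hcard : Nat.card M ≤ 2 ^ (b * S))
    (P : ℕ) (init : M) (step : M → Tok → PMF M) (endPass : M → PMF M) (output : M → Out) :
    ∃ A : StreamingAlgorithm b Tok Out, A.space = S ∧ A.passes = P ∧ ∀ σ,
      A.outputDist σ = (multiRun init (passRun step endPass σ) P).map output := by
  classical
  have := Fintype.ofFinite M
  rw [Nat.card_eq_fintype_card] at hcard
  have hW : Fintype.card (Fin S → Word b) = 2 ^ (b * S) := by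
    simp [pow_mul]
  obtain ⟨f⟩ : Nonempty (M ↪ (Fin S → Word b)) :=
    Function.Embedding.nonempty_of_card_le (by rw [hW]; exact hcard)
  have : Nonempty M := ⟨init⟩
  let g : (Fin S → Word b) → M := Function.invFun f
  have hg : ∀ m, g (f m) = m := Function.leftInverse_invFun f.injective
  let A : StreamingAlgorithm b Tok Out :=
    { space := S
      passes := P
      init := f init
      step := fun m e => (step (g m) e).map f
      endPass := fun m => (endPass (g m)).map f
      output := fun m => output (g m) }
  have hpass : ∀ σ m, A.runPass σ (f m) = (passRun step endPass σ m).map f := by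
    intro σ
    induction σ with
    | nil =>
      intro m
      change (endPass (g (f m))).map f = _
      rw [hg]; rfl
    | cons e σ ih =>
      intro m
      change ((step (g (f m)) e).map f).bind (A.runPass σ) =
        ((step m e).bind (passRun step endPass σ)).map f
      rw [hg, PMF.bind_map, PMF.map_bind]
      congr 1
      funext m'
      exact ih m'
  have hrun : ∀ σ p, A.run σ p = (multiRun init (passRun step endPass σ) p).map f := by
    intro σ p
    induction p with
    | zero => exact (PMF.pure_map f init).symm
    | succ p ih =>
      change (A.run σ p).bind (A.runPass σ) = ((multiRun init _ p).bind _).map f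
      rw [ih, PMF.bind_map, PMF.map_bind]
      congr 1
      funext m
      exact hpass σ m
  refine ⟨A, rfl, rfl, fun σ => ?_⟩
  change (A.run σ P).map A.output = _
  rw [hrun, PMF.map_comp]
  congr 1
  funext m
  exact congrArg output (hg m)

/-- Union bound over one transition: either the start is already in `A`, or the transition itself
fails, with probability at most `η`. -/
lemma toOuterMeasure_bind_le {α β : Type} (p : PMF α) (f : α → PMF β) (A : Set α) (B : Set β)
    (η : ℝ≥0∞) (h : ∀ a ∈ p.support, a ∉ A → (f a).toOuterMeasure B ≤ η) :
    (p.bind f).toOuterMeasure B ≤ p.toOuterMeasure A + η := by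
  classical
  rw [PMF.toOuterMeasure_bind_apply, PMF.toOuterMeasure_apply]
  calc ∑' a, p a * (f a).toOuterMeasure B ≤ ∑' a, (A.indicator p a + p a * η) := by
        refine ENNReal.tsum_le_tsum fun a => ?_
        by_cases ha : a ∈ A
        · rw [Set.indicator_of_mem ha]
          refine le_trans ?_ le_self_add
          refine mul_le_of_le_one_right' ?_
          refine le_trans ((f a).toOuterMeasure.mono (Set.subset_univ _)) ?_
          exact ((PMF.toOuterMeasure_apply_eq_one_iff _ _).2 (Set.subset_univ _)).le
        · rw [Set.indicator_of_notMem ha, zero_add]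
          by_cases hp : p a = 0
          · simp [hp]
          · gcongr
            exact h a ((p.mem_support_iff a).2 hp) ha
    _ = _ := by
        rw [ENNReal.tsum_add, ENNReal.tsum_mul_right, PMF.tsum_coe, one_mul]

lemma one_sub_le_toOuterMeasure_compl {α : Type} (p : PMF α) (A : Set α) (η : ℝ≥0∞)
    (h : p.toOuterMeasure A ≤ η) : 1 - η ≤ p.toOuterMeasure Aᶜ := by
  rw [tsub_le_iff_left]
  have h1 : p.toOuterMeasure Set.univ = 1 :=
    (PMF.toOuterMeasure_apply_eq_one_iff _ _).2 (Set.subset_univ _)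
  rw [← h1, ← Set.union_compl_self A]
  refine (MeasureTheory.measure_union_le (μ := p.toOuterMeasure) _ _).trans ?_
  gcongr

end Machine

/-! ### Independent sampling into a bounded buffer. -/

section Sampling

variable {T : Type}

lemma prod_one_add_le_exp (ρ : T → ℝ) (hρ : ∀ x, 0 ≤ ρ x) (σ : List T) :
    (σ.map fun x => 1 + ENNReal.ofReal (ρ x)).prod ≤ ENNReal.ofReal (Real.exp (σ.map ρ).sum) := by
  induction σ with
  | nil => simp
  | cons x σ ih =>
    simp only [List.map_cons, List.prod_cons, List.sum_cons]
    rw [Real.exp_add, ENNReal.ofReal_mul (Real.exp_pos _).le]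
    refine mul_le_mul' ?_ ih
    rw [← ENNReal.ofReal_one, ← ENNReal.ofReal_add zero_le_one (hρ x)]
    exact ENNReal.ofReal_le_ofReal (by linarith [Real.add_one_le_exp (ρ x)])

-- This is `1 - ρ ≤ exp (-ρ)` factor by factor. Truncating the rate at `1` does no harm, since such
-- a factor is `0`.
open Classical in
lemma prod_one_sub_le_exp (ρ : T → ℝ) (hρ : ∀ x, 0 ≤ ρ x) (X : Set T) (σ : List T) :
    (σ.map fun x => if x ∈ X then 1 - min 1 (ENNReal.ofReal (ρ x)) else 1).prod ≤
      ENNReal.ofReal (Real.exp (-(σ.map fun x => if x ∈ X then ρ x else 0).sum)) := by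
  induction σ with
  | nil => simp
  | cons x σ ih =>
    simp only [List.map_cons, List.prod_cons, List.sum_cons]
    rw [neg_add, Real.exp_add, ENNReal.ofReal_mul (Real.exp_pos _).le]
    refine mul_le_mul' ?_ ih
    split_ifs
    · rw [← ENNReal.ofReal_one, ← ENNReal.ofReal_min, ← ENNReal.ofReal_sub _ (by
        exact le_min zero_le_one (hρ x))]
      refine ENNReal.ofReal_le_ofReal ?_
      rcases le_total 1 (ρ x) with h | h
      · rw [min_eq_left h, sub_self]; exact (Real.exp_pos _).le
      · rw [min_eq_right h]; linarith [Real.add_one_le_exp (-ρ x)]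
    · simp

variable [DecidableEq T]

/-- The coin that shows `true` with probability `min 1 x`. -/
noncomputable def coin (x : ℝ≥0∞) : PMF Bool :=
  PMF.ofFintype (fun b => cond b (min 1 x) (1 - min 1 x)) (by
    simp [add_tsub_cancel_of_le])

lemma toOuterMeasure_coin_bind {α : Type} (x : ℝ≥0∞) (f : Bool → PMF α) (A : Set α) :
    ((coin x).bind f).toOuterMeasure A =
      min 1 x * (f true).toOuterMeasure A + (1 - min 1 x) * (f false).toOuterMeasure A := by
  rw [PMF.toOuterMeasure_bind_apply, tsum_fintype, Fintype.sum_bool]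
  rfl

/-- The sets of at most `L` elements. -/
abbrev BoundedSet (T : Type) (L : ℕ) : Type := {A : Finset T // A.card ≤ L}

/-- Insert an element if there is room for it. -/
def BoundedSet.push {L : ℕ} (A : BoundedSet T L) (x : T) : BoundedSet T L :=
  if h : (insert x A.1).card ≤ L then ⟨insert x A.1, h⟩ else A

/-- Independent sampling into a buffer of size `L`. -/
noncomputable def sampleRun (r : T → ℝ≥0∞) (L : ℕ) : List T → BoundedSet T L → PMF (BoundedSet T L)
  | [], A => PMF.pure A
  | x :: σ, A => (coin (r x)).bind fun b => sampleRun r L σ (if b then A.push x else A)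

variable {L : ℕ}

lemma BoundedSet.subset_push (A : BoundedSet T L) (x : T) : A.1 ⊆ (A.push x).1 := by
  unfold BoundedSet.push
  split_ifs
  · exact Finset.subset_insert _ _
  · exact subset_rfl

lemma BoundedSet.push_subset (A : BoundedSet T L) (x : T) : (A.push x).1 ⊆ insert x A.1 := by
  unfold BoundedSet.push
  split_ifs
  · exact subset_rfl
  · exact Finset.subset_insert _ _

/-- A sampled token is lost only if the buffer is full, and a full buffer is counted as failure;
otherwise the sample is complete. -/
lemma BoundedSet.mem_push_or_card_eq (A : BoundedSet T L) (x : T) :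
    x ∈ (A.push x).1 ∨ (A.push x).1.card = L := by
  unfold BoundedSet.push
  split_ifs with h
  · exact Or.inl (Finset.mem_insert_self _ _)
  · right
    have h1 := Finset.card_insert_le x A.1
    have h2 := A.2
    omega

lemma subset_of_mem_support_sampleRun (r : T → ℝ≥0∞) (σ : List T) (A S : BoundedSet T L)
    (hS : S ∈ (sampleRun r L σ A).support) : A.1 ⊆ S.1 ∧ ∀ x ∈ S.1, x ∈ A.1 ∨ x ∈ σ := by
  induction σ generalizing A with
  | nil =>
    obtain rfl : S = A := by simpa [sampleRun] using hS
    exact ⟨subset_rfl, fun x hx => Or.inl hx⟩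
  | cons y σ ih =>
    rw [sampleRun, PMF.mem_support_bind_iff] at hS
    obtain ⟨b, -, hb⟩ := hS
    obtain ⟨h1, h2⟩ := ih _ hb
    cases b with
    | false =>
      refine ⟨by simpa using h1, fun x hx => ?_⟩
      rcases h2 x hx with h | h
      · exact Or.inl (by simpa using h)
      · exact Or.inr (List.mem_cons_of_mem _ h)
    | true =>
      refine ⟨(A.subset_push y).trans (by simpa using h1), fun x hx => ?_⟩
      rcases h2 x hx with h | h
      · rcases Finset.mem_insert.1 (A.push_subset y (by simpa using h)) with rfl | h
        · exact Or.inr (by simp)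
        · exact Or.inl h
      · exact Or.inr (List.mem_cons_of_mem _ h)

/-- The buffer is rarely full. -/
lemma two_pow_mul_toOuterMeasure_full_le (r : T → ℝ≥0∞) (σ : List T) (A : BoundedSet T L) :
    2 ^ L * (sampleRun r L σ A).toOuterMeasure {S | S.1.card = L} ≤
      2 ^ A.1.card * (σ.map fun x => 1 + r x).prod := by
  induction σ generalizing A with
  | nil =>
    simp only [sampleRun, PMF.toOuterMeasure_pure_apply, List.map_nil, List.prod_nil, mul_one,
      Set.mem_ofPred_eq]
    split_ifs with h
    · rw [h, mul_one]
    · simp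
  | cons x σ ih =>
    rw [sampleRun, toOuterMeasure_coin_bind]
    simp only [if_true, Bool.false_eq_true, if_false, List.map_cons, List.prod_cons]
    set Q := (σ.map fun x => 1 + r x).prod
    set p := min 1 (r x) with hp
    -- Exponential moment: a push at most doubles the potential `2 ^ card` and happens with
    -- probability at most `r x`, so its expectation grows by a factor of at most `1 + r x`.
    have h1 : 2 ^ L * (sampleRun r L σ (A.push x)).toOuterMeasure {S | S.1.card = L} ≤
        2 * 2 ^ A.1.card * Q := by
      refine (ih (A.push x)).trans ?_
      rw [← pow_succ']
      gcongr
      · norm_num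
      · exact (Finset.card_le_card (A.push_subset x)).trans (Finset.card_insert_le _ _)
    have h2 := ih A
    have hp1 : p + (1 - p) = 1 := add_tsub_cancel_of_le (min_le_left _ _)
    calc 2 ^ L * (p * (sampleRun r L σ (A.push x)).toOuterMeasure {S | S.1.card = L} +
          (1 - p) * (sampleRun r L σ A).toOuterMeasure {S | S.1.card = L})
        = p * (2 ^ L * (sampleRun r L σ (A.push x)).toOuterMeasure {S | S.1.card = L}) +
          (1 - p) * (2 ^ L * (sampleRun r L σ A).toOuterMeasure {S | S.1.card = L}) := by ring
      _ ≤ p * (2 * 2 ^ A.1.card * Q) + (1 - p) * (2 ^ A.1.card * Q) := by gcongr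
      _ = 2 ^ A.1.card * ((p + (1 - p) + p) * Q) := by ring
      _ ≤ _ := by
        rw [hp1]
        gcongr
        exact min_le_right _ _

open Classical in
/-- The sample rarely avoids a given set. -/
lemma toOuterMeasure_avoid_le (r : T → ℝ≥0∞) (X : Set T) (σ : List T) (A : BoundedSet T L) :
    (sampleRun r L σ A).toOuterMeasure {S | S.1.card ≠ L ∧ ∀ x ∈ S.1, x ∉ X} ≤
      (σ.map fun x => if x ∈ X then 1 - min 1 (r x) else 1).prod := by
  induction σ generalizing A with
  | nil =>
    simp only [sampleRun, PMF.toOuterMeasure_pure_apply, List.map_nil, List.prod_nil]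
    split_ifs <;> simp
  | cons x σ ih =>
    rw [sampleRun, toOuterMeasure_coin_bind]
    simp only [if_true, Bool.false_eq_true, if_false, List.map_cons, List.prod_cons]
    by_cases hx : x ∈ X
    · rw [if_pos hx]
      have h0 : (sampleRun r L σ (A.push x)).toOuterMeasure
          {S | S.1.card ≠ L ∧ ∀ x ∈ S.1, x ∉ X} = 0 := by
        rw [PMF.toOuterMeasure_apply_eq_zero_iff, Set.disjoint_left]
        rintro S hS ⟨h1, h2⟩
        have hsub := (subset_of_mem_support_sampleRun r σ _ S hS).1
        rcases A.mem_push_or_card_eq x with h | h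
        · exact h2 x (hsub h) hx
        · have := Finset.card_le_card hsub
          have := S.2
          omega
      rw [h0, mul_zero, zero_add]
      gcongr
      exact ih A
    · rw [if_neg hx, one_mul]
      refine (add_le_add (mul_le_mul_right (ih _) _) (mul_le_mul_right (ih _) _)).trans ?_
      rw [← add_mul, add_tsub_cancel_of_le (min_le_left _ _), one_mul]

open Classical in
/-- With high probability the buffer is not full and meets every heavy set of a small family. -/
theorem toOuterMeasure_sampleRun_bad_le {I : Type} (ρ : T → ℝ) (hρ : ∀ x, 0 ≤ ρ x) (σ : List T)
    (𝒯 : Finset I) (X : I → Set T) (s a : ℝ) (hL : 3 * s ≤ L) (hs : (σ.map ρ).sum ≤ s)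
    (hX : ∀ i ∈ 𝒯, a ≤ (σ.map fun x => if x ∈ X i then ρ x else 0).sum) :
    (sampleRun (fun x => ENNReal.ofReal (ρ x)) L σ ⟨∅, by simp⟩).toOuterMeasure
        {S | S.1.card = L ∨ ∃ i ∈ 𝒯, ∀ x ∈ S.1, x ∉ X i} ≤
      ENNReal.ofReal (Real.exp (-s) + 𝒯.card * Real.exp (-a)) := by
  set μ := (sampleRun (fun x => ENNReal.ofReal (ρ x)) L σ ⟨∅, by simp⟩).toOuterMeasure
  have hsub : {S : BoundedSet T L | S.1.card = L ∨ ∃ i ∈ 𝒯, ∀ x ∈ S.1, x ∉ X i} ⊆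
      {S | S.1.card = L} ∪ ⋃ i ∈ 𝒯, {S | S.1.card ≠ L ∧ ∀ x ∈ S.1, x ∉ X i} := by
    intro S hS
    by_cases h : S.1.card = L
    · exact Or.inl h
    · obtain ⟨i, hi, hd⟩ := hS.resolve_left h
      exact Or.inr (Set.mem_biUnion hi ⟨h, hd⟩)
  have hfull : μ {S | S.1.card = L} ≤ ENNReal.ofReal (Real.exp (-s)) := by
    have h1 := two_pow_mul_toOuterMeasure_full_le (L := L) (fun x => ENNReal.ofReal (ρ x)) σ
      ⟨∅, by simp⟩
    have h2 := h1.trans (mul_le_mul_right (prod_one_add_le_exp ρ hρ σ) _)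
    simp only [Finset.card_empty, pow_zero, one_mul] at h2
    have h3 : ENNReal.ofReal (Real.exp (σ.map ρ).sum) ≤
        2 ^ L * ENNReal.ofReal (Real.exp (-s)) := by
      rw [show (2 : ℝ≥0∞) ^ L = ENNReal.ofReal (2 ^ L) by
        rw [ENNReal.ofReal_pow (by norm_num)]; norm_num, ← ENNReal.ofReal_mul (by positivity)]
      refine ENNReal.ofReal_le_ofReal ?_
      -- The `3` in `hL` is chosen because `3 * log 2 > 2`: one `exp s` pays for the moment, the
      -- other is the failure bound.
      have h4 : Real.exp (2 * s) ≤ 2 ^ L := by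
        rw [← Real.rpow_natCast, Real.rpow_def_of_pos (by norm_num), Real.exp_le_exp]
        have hlog := Real.log_two_gt_d9
        have hs0 : 0 ≤ s := le_trans (List.sum_nonneg (by
          intro y hy
          obtain ⟨x, -, rfl⟩ := List.mem_map.1 hy
          exact hρ x)) hs
        nlinarith
      calc Real.exp (σ.map ρ).sum ≤ Real.exp s := Real.exp_le_exp.2 hs
        _ = Real.exp (2 * s) * Real.exp (-s) := by rw [← Real.exp_add]; ring_nf
        _ ≤ _ := by gcongr
    have h5 := h2.trans h3
    rwa [ENNReal.mul_le_mul_iff_right (by positivity) (by finiteness)] at h5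
  calc μ _ ≤ μ {S | S.1.card = L} + μ (⋃ i ∈ 𝒯, {S | S.1.card ≠ L ∧ ∀ x ∈ S.1, x ∉ X i}) :=
        (μ.mono hsub).trans (MeasureTheory.measure_union_le (μ := μ) _ _)
    _ ≤ ENNReal.ofReal (Real.exp (-s)) + ∑ i ∈ 𝒯, ENNReal.ofReal (Real.exp (-a)) := by
        refine add_le_add hfull ((MeasureTheory.measure_biUnion_finset_le (μ := μ) _ _).trans ?_)
        refine Finset.sum_le_sum fun i hi => ?_
        refine (toOuterMeasure_avoid_le _ (X i) σ _).trans
          ((prod_one_sub_le_exp ρ hρ (X i) σ).trans (ENNReal.ofReal_le_ofReal ?_))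
        exact Real.exp_le_exp.2 (neg_le_neg (hX i hi))
    _ = _ := by
        rw [Finset.sum_const, nsmul_eq_mul, ENNReal.ofReal_add (by positivity) (by positivity),
          ENNReal.ofReal_mul (by positivity), ENNReal.ofReal_natCast]

end Sampling

/-! ### Counting memory contents. -/

section Counting

lemma card_boundedList_le (T : Type) [Fintype T] (L : ℕ) :
    Nat.card {l : List T // l.length ≤ L} ≤ (Fintype.card T + 1) ^ L := by
  classical
  let f : {l : List T // l.length ≤ L} → (Fin L → Option T) := fun l i => l.1[i.1]?
  have hf : Function.Injective f := by
    intro l l' h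
    refine Subtype.ext (List.ext_getElem? fun i => ?_)
    by_cases hi : i < L
    · exact congrFun h ⟨i, hi⟩
    · rw [List.getElem?_eq_none (by have := l.2; omega),
        List.getElem?_eq_none (by have := l'.2; omega)]
  refine (Nat.card_le_card_of_injective f hf).trans ?_
  simp

instance finite_boundedList (T : Type) [Finite T] (L : ℕ) : Finite {l : List T // l.length ≤ L} :=
  (List.finite_length_le T L).to_subtype

lemma card_boundedSet_le (T : Type) [Fintype T] (L : ℕ) :
    Nat.card (BoundedSet T L) ≤ (Fintype.card T + 1) ^ L := by
  classical
  let f : BoundedSet T L → {l : List T // l.length ≤ L} := fun A => ⟨A.1.toList, by simpa using A.2⟩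
  have hf : Function.Injective f := by
    intro A A' h
    have : A.1.toList = A'.1.toList := congrArg Subtype.val h
    refine Subtype.ext ?_
    rw [← Finset.toList_toFinset A.1, this, Finset.toList_toFinset]
  exact (Nat.card_le_card_of_injective f hf).trans (card_boundedList_le T L)

end Counting

/-! ### Trees of the rounds and correctness of their union. -/

section Trees

variable {V W : Type} {val : W → ℝ≥0} {G : SimpleGraph V} {w : Sym2 V → W} {s : V}

/-- A shortest-path tree as a set of tokens. -/
lemma exists_tree_tokens [Fintype V] (A : Finset (Sym2 V × W))
    (hA : (A : Set (Sym2 V × W)) ⊆ tokensOf G w)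
    (s : V) :
    ∃ T : BoundedSet (Sym2 V × W) (Fintype.card V), T.1 ⊆ A ∧
      ∀ v, tokenDist val (T.1 : Set (Sym2 V × W)) s v =
        tokenDist val (A : Set (Sym2 V × W)) s v := by
  classical
  obtain ⟨T, hT⟩ := exists_shortestPathTree (graphOf (A : Set (Sym2 V × W)))
    (fun e => val (w e)) s
  set B := A.filter fun x => x.1 ∈ T.edgeSet with hB
  have hBA : B ⊆ A := Finset.filter_subset _ _
  have hBtok : (B : Set (Sym2 V × W)) ⊆ tokensOf G w := fun x hx => hA (hBA hx)
  have hgB : graphOf (B : Set (Sym2 V × W)) = T := by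
    ext u v
    rw [graphOf_adj]
    constructor
    · rintro ⟨⟨x, hx, hxe⟩, -⟩
      have := (Finset.mem_filter.1 hx).2
      rwa [hxe] at this
    · intro h
      obtain ⟨⟨x, hx, hxe⟩, hne⟩ := graphOf_adj.1 (hT.le h)
      refine ⟨⟨x, ?_, hxe⟩, hne⟩
      rw [hB, Finset.mem_coe, Finset.mem_filter]
      exact ⟨hx, by rw [hxe]; exact h⟩
  have hcard : B.card ≤ Fintype.card V := by
    rw [← Finset.card_image_of_injOn ((injOn_fst_tokensOf G w).mono hBtok)]
    refine card_le_of_isAcyclic _ ?_ ?_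
    · intro e he
      obtain ⟨x, hx, rfl⟩ := Finset.mem_image.1 he
      exact not_isDiag_of_mem_tokensOf (hBtok hx)
    · rw [Finset.coe_image]
      change (graphOf (B : Set (Sym2 V × W))).IsAcyclic
      rw [hgB]
      exact hT.acyclic
  refine ⟨⟨B, hcard⟩, hBA, fun v => ?_⟩
  rw [tokenDist_eq hBtok, tokenDist_eq hA, hgB]
  refine le_antisymm ?_ (wdist_mono hT.le)
  have := hT.wdist_le v
  simpa using this

/-- The token `x` witnesses that the distances in `T` are not those of a graph containing it. -/
def Violates (val : W → ℝ≥0) (s : V) (T : Set (Sym2 V × W)) (x : Sym2 V × W) : Prop :=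
  ∃ u v, x.1 = s(u, v) ∧ tokenDist val T s u + val x.2 < tokenDist val T s v

/-- `T` has the distances of a graph that contains `F`, `H` and `K`. -/
structure IsRoundTree (val : W → ℝ≥0) (s : V) (P F H K T : Set (Sym2 V × W)) : Prop where
  subset : T ⊆ P
  exists_eq : ∃ A, A ⊆ P ∧ F ⊆ A ∧ H ⊆ A ∧ K ⊆ A ∧ ∀ v, tokenDist val T s v = tokenDist val A s v

/-- The distances in `T` are those of a graph containing `x`. In particular no sampled token is
violated: a tree whose violated set meets the sample cannot be the outcome of the round. -/
lemma not_violates_of_mem {A T : Set (Sym2 V × W)} (hA : A ⊆ tokensOf G w)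
    (h : ∀ v, tokenDist val T s v = tokenDist val A s v) {x : Sym2 V × W} (hx : x ∈ A) :
    ¬ Violates val s T x := by
  rintro ⟨u, v, huv, hlt⟩
  rw [h, h, tokenDist_eq hA, tokenDist_eq hA] at hlt
  refine hlt.not_ge ((wdist_triangle (v := u)).trans ?_)
  gcongr
  by_cases hne : u = v
  · subst hne; simp [wdist_self]
  · refine (wdist_adj (graphOf_adj.2 ⟨⟨x, hx, huv⟩, hne⟩)).trans ?_
    rw [← huv, (hA hx).2]

variable {P F H K T : Set (Sym2 V × W)}

lemma IsRoundTree.le_add_wdist (hP : P ⊆ tokensOf G w) (h : IsRoundTree val s P F H K T)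
    {B : Set (Sym2 V × W)} (hB : B ⊆ F ∨ B ⊆ H ∨ B ⊆ K) (u v : V) :
    tokenDist val T s v ≤ tokenDist val T s u + wdist (graphOf B) (fun e => val (w e)) u v := by
  obtain ⟨A, hAP, hFA, hHA, hKA, heq⟩ := h.exists_eq
  rw [heq, heq, tokenDist_eq (hAP.trans hP), tokenDist_eq (hAP.trans hP)]
  refine (wdist_triangle (v := u)).trans ?_
  gcongr
  refine wdist_mono (graphOf_mono ?_)
  rcases hB with hB | hB | hB
  · exact hB.trans hFA
  · exact hB.trans hHA
  · exact hB.trans hKA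

open Classical in
/-- Trees that are rarely violated together contain short paths to all vertices. -/
theorem isApproxShortestPathTree_of_rounds [Fintype V] [DecidableEq V] {m k : ℕ} {ε : ℝ}
    (hε : 0 < ε)
    (hk : 1 ≤ k)
    {F H K : Finset (Sym2 V × W)} (hFP : (F : Set (Sym2 V × W)) ⊆ tokensOf G w)
    (hF : ∀ x ∈ tokensOf G w, BottleneckConnected val (F : Set (Sym2 V × W)) x)
    (hH : IsGreedySpanner val (tokenDist val (F : Set (Sym2 V × W)) s) m k H (tokensOf G w))
    (hK : IsHookSet val (tokenDist val (F : Set (Sym2 V × W)) s) m K (tokensOf G w))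
    {ι : Type} [Fintype ι] [Nonempty ι] (T : ι → Set (Sym2 V × W))
    (hT : ∀ i, IsRoundTree val s (tokensOf G w) (F : Set (Sym2 V × W))
      (H : Set (Sym2 V × W)) (K : Set (Sym2 V × W)) (T i))
    (hviol : ∀ x ∈ tokensOf G w, (Finset.univ.filter fun i => Violates val s (T i) x).card ≤ 3 * k)
    (hR : 24 * (k : ℝ) ^ 2 ≤ ε * Fintype.card ι)
    (hm : 2 * (Fintype.card V : ℝ) ^ 3 ≤ ε * 2 ^ m) {O : SimpleGraph V}
    (hO : IsApproxShortestPathTree (graphOf (⋃ i, T i)) (weightOf val (⋃ i, T i)) s 0 O) :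
    IsApproxShortestPathTree G (fun e => val (w e)) s ε O := by
  set D := tokenDist val (F : Set (Sym2 V × W)) s with hDdef
  have hUP : (⋃ i, T i) ⊆ tokensOf G w := Set.iUnion_subset fun i => (hT i).subset
  have hn0 : 0 < Fintype.card V := Fintype.card_pos_iff.2 ⟨s⟩
  have hDs : D s = 0 := by rw [hDdef]; exact wdist_self
  have hTs : ∀ i, tokenDist val (T i) s s = 0 := fun i => wdist_self
  have htok : ∀ {u v}, G.Adj u v → (s(u, v), w s(u, v)) ∈ tokensOf G w := fun h => ⟨h, rfl⟩
  have hDlight : ∀ u v, G.Adj u v →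
      wdist (graphOf (F : Set (Sym2 V × W))) (fun e => val (w e)) u v ≤
        Fintype.card V * (val (w s(u, v)) : ℝ≥0∞) := fun u v huv =>
    wdist_le_card_mul_of_bottleneckConnected hFP (hF _ (htok huv)) rfl
  have hD : ∀ v, D v ≤ Fintype.card V * wdist G (fun e => val (w e)) s v := by
    intro v
    have hne : (Fintype.card V : ℝ≥0∞) ≠ 0 := by positivity
    have hnt : (Fintype.card V : ℝ≥0∞) ≠ ⊤ := by finiteness
    -- Along every edge of `G`, `D` grows by at most `n` times its weight, so `D / n` grows no
    -- faster than the distance.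
    have := le_add_wdist_of_adj (G := G) (w := fun e => val (w e)) (u := s) (v := v)
      (fun v => D v / Fintype.card V) (by
        intro a b hab
        rw [ENNReal.div_le_iff hne hnt, add_mul, ENNReal.div_mul_cancel hne hnt,
          mul_comm (_ : ℝ≥0∞) (Fintype.card V : ℝ≥0∞)]
        simp only [hDdef, tokenDist_eq hFP]
        refine (wdist_triangle (v := a)).trans ?_
        gcongr
        exact hDlight a b hab)
    rw [ENNReal.div_le_iff hne hnt] at this
    simpa [hDs, mul_comm] using this
  have key : ∀ z, ∃ i, tokenDist val (T i) s z ≤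
      (1 + (ε.toNNReal : ℝ≥0∞)) * wdist G (fun e => val (w e)) s z := by
    refine exists_le_one_add_mul_wdist G (fun e => val (w e)) s
      (fun i v => tokenDist val (T i) s v) D m k ε.toNNReal hTs ?_ hD ?_ ?_ ?_ ?_ ?_
    · intro i v
      have := (hT i).le_add_wdist subset_rfl (Or.inl subset_rfl) s v
      rwa [hTs, zero_add, ← tokenDist_eq hFP] at this
    · intro i u v huv
      refine ((hT i).le_add_wdist subset_rfl (Or.inl subset_rfl) u v).trans ?_
      gcongr
      exact hDlight u v huv
    · intro i u v huv h1 h2 h3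
      -- If `D u` is at most the weight, the edge hooks at `v`; otherwise it is comparable at both
      -- ends and the spanner covers it.
      by_cases h4 : D u ≤ val (w s(u, v))
      · refine (hK.le_four_mul (htok huv) ⟨u, rfl, h4, h1, h2⟩
          (fun v => tokenDist val (T i) s v) ?_ ?_).trans ?_
        · intro v
          have := (hT i).le_add_wdist subset_rfl (Or.inl subset_rfl) s v
          rwa [hTs, zero_add, ← tokenDist_eq hFP] at this
        · intro y hy a b hab
          refine ((hT i).le_add_wdist subset_rfl (Or.inr (Or.inr subset_rfl)) a b).trans ?_
          gcongr
          by_cases hne : a = b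
          · subst hne; simp [wdist_self]
          · refine (wdist_adj (graphOf_adj.2 ⟨⟨y, hy, hab⟩, hne⟩)).trans ?_
            rw [← hab, (hK.subset hy).2]
        · refine le_trans ?_ le_add_self
          rw [mul_assoc]
          gcongr
          refine le_mul_of_one_le_left' ?_
          exact_mod_cast hk
      · refine ((hT i).le_add_wdist subset_rfl (Or.inr (Or.inl subset_rfl)) u v).trans ?_
        gcongr
        refine hH.wdist_le subset_rfl (htok huv) ?_ rfl
        intro a ha
        rcases Sym2.mem_iff.1 ha with rfl | rfl
        · exact ⟨not_le.1 h4, h3⟩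
        · exact ⟨h1, h2⟩
    · intro u v huv
      refine (Finset.card_le_card fun i hi => ?_).trans (hviol _ (htok huv))
      simp only [Finset.mem_filter, Finset.mem_univ, true_and, not_le] at hi ⊢
      exact ⟨u, v, rfl, hi⟩
    · rw [← NNReal.coe_le_coe]
      push_cast
      rwa [Real.coe_toNNReal _ hε.le]
    · rw [← NNReal.coe_le_coe]
      push_cast
      rwa [Real.coe_toNNReal _ hε.le]
  have hreach : ∀ v, (graphOf (⋃ i, T i)).Reachable s v ↔ G.Reachable s v := by
    intro v
    refine ⟨fun h => h.mono (graphOf_le hUP), fun h => ?_⟩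
    obtain ⟨i, hi⟩ := key v
    have h1 : tokenDist val (T i) s v ≠ ⊤ :=
      ne_top_of_le_ne_top (ENNReal.mul_ne_top (by finiteness) (wdist_ne_top h)) hi
    exact (wdist_ne_top_iff.1 h1).mono (graphOf_mono (Set.subset_iUnion T i))
  refine ⟨hO.le.trans (graphOf_le hUP), hO.acyclic, hO.reachable_of_adj,
    fun v => (hO.reachable_iff v).trans (hreach v), fun v => ?_⟩
  obtain ⟨i, hi⟩ := key v
  have h1 := hO.wdist_le v
  rw [wdist_congr_weight (w' := fun e => val (w e)) fun e he =>
    weightOf_eq hUP (SimpleGraph.edgeSet_mono hO.le he)] at h1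
  refine h1.trans ?_
  rw [add_zero, ENNReal.ofReal_one, one_mul, ENNReal.ofReal_add zero_le_one hε.le,
    ENNReal.ofReal_one]
  refine le_trans ?_ hi
  change tokenDist val (⋃ i, T i) s v ≤ _
  rw [tokenDist_eq hUP, tokenDist_eq (hT i).subset]
  exact wdist_mono (graphOf_mono (Set.subset_iUnion T i))

end Trees

/-! ### The algorithm and its deterministic passes. -/

section Algorithm

/-- The parameters of the algorithm: the vertex `root`, the range `2 ^ m` of relevant weights, the
stretch parameter `k`, the sizes of the spanner, the hook set and the sampling buffer, the number of
sampling rounds, the factor by which the importance of a violated edge grows, and the expected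
number of samples. -/
structure Parameters (V W : Type) where
  val : W → ℝ≥0
  root : V
  m : ℕ
  k : ℕ
  spannerSize : ℕ
  hookSize : ℕ
  bufferSize : ℕ
  rounds : ℕ
  factor : ℝ
  intensity : ℝ

namespace Parameters

variable {V W : Type} [Fintype V]

instance {T : Type} {L : ℕ} : Nonempty (BoundedSet T L) := ⟨⟨∅, by simp⟩⟩

/-- The trees of the finished rounds. -/
abbrev History (p : Parameters V W) : Type :=
  {l : List (BoundedSet (Sym2 V × W) (Fintype.card V)) // l.length ≤ p.rounds}

/-- The phase (`none` for the spanning forest, `some false` for the spanner and the hooks,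
`some true` for sampling), the forest, the spanner, the hooks, the trees and the sample. -/
abbrev State (p : Parameters V W) : Type :=
  Option Bool × BoundedSet (Sym2 V × W) (Fintype.card V) × BoundedSet (Sym2 V × W) p.spannerSize ×
    BoundedSet (Sym2 V × W) p.hookSize × p.History × BoundedSet (Sym2 V × W) p.bufferSize

variable (p : Parameters V W)

/-- The distances from the root in the forest. -/
noncomputable def forestDist (F : Finset (Sym2 V × W)) : V → ℝ≥0∞ :=
  tokenDist p.val (F : Set (Sym2 V × W)) p.root

/-- A shortest-path tree of a set of tokens. -/
noncomputable def treeOf (A : Finset (Sym2 V × W)) : BoundedSet (Sym2 V × W) (Fintype.card V) :=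
  Classical.epsilon fun T => T.1 ⊆ A ∧ ∀ v, tokenDist p.val (T.1 : Set (Sym2 V × W)) p.root v =
    tokenDist p.val (A : Set (Sym2 V × W)) p.root v

open Classical in
/-- The number of trees violated by a token. -/
noncomputable def violations (l : List (BoundedSet (Sym2 V × W) (Fintype.card V)))
    (x : Sym2 V × W) : ℕ :=
  (Finset.univ.filter fun i : Fin l.length =>
    Violates p.val p.root ((l.get i).1 : Set (Sym2 V × W)) x).card

/-- The importance of a token. -/
noncomputable def importance (l : List (BoundedSet (Sym2 V × W) (Fintype.card V)))
    (x : Sym2 V × W) : ℝ := p.factor ^ p.violations l x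

/-- A bound for the total importance after `i` rounds. -/
noncomputable def totalBound (i : ℕ) : ℝ :=
  (Fintype.card V : ℝ) ^ 2 * (1 + p.k / p.rounds) ^ i

/-- The sampling rate. -/
noncomputable def rate (l : List (BoundedSet (Sym2 V × W) (Fintype.card V)))
    (x : Sym2 V × W) : ℝ := p.intensity * p.importance l x / p.totalBound l.length

/-- Record the tree of a round. -/
def record (l : p.History) (T : BoundedSet (Sym2 V × W) (Fintype.card V)) : p.History :=
  if h : l.1.length < p.rounds then ⟨T :: l.1, h⟩ else l

/-- The output. -/
noncomputable def output (st : p.State) : SimpleGraph V :=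
  let U : Set (Sym2 V × W) :=
    ⋃ i : Fin st.2.2.2.2.1.1.length, ((st.2.2.2.2.1.1.get i).1 : Set (Sym2 V × W))
  Classical.epsilon fun T => IsApproxShortestPathTree (graphOf U) (weightOf p.val U) p.root 0 T

open Classical in
lemma violations_cons {p : Parameters V W} (T : BoundedSet (Sym2 V × W) (Fintype.card V))
    (l : List (BoundedSet (Sym2 V × W) (Fintype.card V))) (x : Sym2 V × W) :
    p.violations (T :: l) x =
      p.violations l x + if Violates p.val p.root (T.1 : Set (Sym2 V × W)) x then 1 else 0 := by
  unfold violations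
  have := Fin.card_filter_univ_succ (n := l.length)
    (fun i : Fin (l.length + 1) => Violates p.val p.root (((T :: l).get i).1 : Set (Sym2 V × W)) x)
  refine this.trans ?_
  split_ifs with h h' h'
  · rfl
  · exact absurd h h'
  · exact absurd h' h
  · rfl

lemma treeOf_spec {p : Parameters V W} {G : SimpleGraph V} {w : Sym2 V → W}
    (A : Finset (Sym2 V × W)) (hA : (A : Set (Sym2 V × W)) ⊆ tokensOf G w) :
    (p.treeOf A).1 ⊆ A ∧ ∀ v, tokenDist p.val ((p.treeOf A).1 : Set (Sym2 V × W)) p.root v =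
      tokenDist p.val (A : Set (Sym2 V × W)) p.root v :=
  Classical.epsilon_spec (exists_tree_tokens A hA p.root)

variable [DecidableEq V] [DecidableEq W]

/-- Update a minimum spanning forest. -/
noncomputable def forestStep (F : BoundedSet (Sym2 V × W) (Fintype.card V)) (x : Sym2 V × W) :
    BoundedSet (Sym2 V × W) (Fintype.card V) :=
  Classical.epsilon fun F' => F'.1 ⊆ insert x F.1 ∧
    ∀ y ∈ insert x F.1, BottleneckConnected p.val (F'.1 : Set (Sym2 V × W)) y

open Classical in
/-- Update the spanner. -/
noncomputable def spannerStep (D : V → ℝ≥0∞) (H : BoundedSet (Sym2 V × W) p.spannerSize)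
    (x : Sym2 V × W) : BoundedSet (Sym2 V × W) p.spannerSize :=
  if Keeps p.val D p.m p.k (H.1 : Set (Sym2 V × W)) x then H.push x else H

open Classical in
/-- Update the hooks. -/
noncomputable def hookStep (D : V → ℝ≥0∞) (K : BoundedSet (Sym2 V × W) p.hookSize)
    (x : Sym2 V × W) : BoundedSet (Sym2 V × W) p.hookSize :=
  if IsNewHook p.val D p.m (K.1 : Set (Sym2 V × W)) x then K.push x else K

/-- The memory update after a token. -/
noncomputable def step : p.State → Sym2 V × W → PMF p.State
  | (none, F, H, K, l, S), x => PMF.pure (none, p.forestStep F x, H, K, l, S)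
  | (some false, F, H, K, l, S), x =>
    PMF.pure (some false, F, p.spannerStep (p.forestDist F.1) H x,
      p.hookStep (p.forestDist F.1) K x, l, S)
  | (some true, F, H, K, l, S), x =>
    (coin (ENNReal.ofReal (p.rate l.1 x))).bind fun b =>
      PMF.pure (some true, F, H, K, l, if b then S.push x else S)

/-- The memory update at the end of a pass. -/
noncomputable def endPass : p.State → PMF p.State
  | (none, F, H, K, l, S) => PMF.pure (some false, F, H, K, l, S)
  | (some false, F, H, K, l, S) => PMF.pure (some true, F, H, K, l, S)
  | (some true, F, H, K, l, S) =>
    PMF.pure (some true, F, H, K, p.record l (p.treeOf (F.1 ∪ H.1 ∪ K.1 ∪ S.1)), ⟨∅, by simp⟩)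

/-- The initial memory. -/
def init : p.State := (none, ⟨∅, by simp⟩, ⟨∅, by simp⟩, ⟨∅, by simp⟩, ⟨[], by simp⟩, ⟨∅, by simp⟩)

variable {p}

/-- Invariants refer to the set of tokens read so far, not to their order, so at the end they speak
of `tokensOf G w` directly. -/
lemma foldl_induction {α T : Type} (f : α → T → α) (U : Set T) (Inv : α → Set T → Prop)
    (h : ∀ a P x, insert x P ⊆ U → Inv a P → Inv (f a x) (insert x P)) (σ : List T)
    (hσ : ∀ x ∈ σ, x ∈ U) (a : α) (P : Set T) (hP : P ⊆ U) (ha : Inv a P) :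
    Inv (σ.foldl f a) (P ∪ {x | x ∈ σ}) := by
  induction σ generalizing a P with
  | nil => simpa using ha
  | cons x σ ih =>
    have hx : insert x P ⊆ U := Set.insert_subset (hσ x (by simp)) hP
    have := ih (fun y hy => hσ y (by simp [hy])) (f a x) (insert x P) hx (h a P x hx ha)
    convert! this using 1
    ext y
    simp only [Set.mem_union, List.mem_cons, Set.mem_ofPred_eq, Set.mem_insert_iff]
    tauto

section Passes

variable {G : SimpleGraph V} {w : Sym2 V → W}

lemma foldl_forestStep (σ : List (Sym2 V × W)) (hσ : {x | x ∈ σ} = tokensOf G w) :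
    ((σ.foldl p.forestStep ⟨∅, by simp⟩).1 : Set (Sym2 V × W)) ⊆ tokensOf G w ∧
      ∀ x ∈ tokensOf G w, BottleneckConnected p.val
        ((σ.foldl p.forestStep ⟨∅, by simp⟩).1 : Set (Sym2 V × W)) x := by
  have := foldl_induction p.forestStep (tokensOf G w)
    (fun F P => (F.1 : Set (Sym2 V × W)) ⊆ P ∧
      ∀ x ∈ P, BottleneckConnected p.val (F.1 : Set (Sym2 V × W)) x) (by
    intro F P x hxP ⟨h1, h2⟩
    have hsub : ((insert x F.1 : Finset _) : Set (Sym2 V × W)) ⊆ insert x P := by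
      rw [Finset.coe_insert]; exact Set.insert_subset_insert h1
    obtain ⟨F', hF', hcard, hb⟩ := exists_minimumSpanningForest p.val (insert x F.1)
      (fun y hy => not_isDiag_of_mem_tokensOf (hxP (hsub hy)))
    obtain ⟨h3, h4⟩ := Classical.epsilon_spec
      (p := fun F' : BoundedSet (Sym2 V × W) (Fintype.card V) => F'.1 ⊆ insert x F.1 ∧
        ∀ y ∈ insert x F.1, BottleneckConnected p.val (F'.1 : Set (Sym2 V × W)) y)
      ⟨⟨F', hcard⟩, hF', hb⟩
    refine ⟨fun y hy => hsub (h3 hy), fun y hy => ?_⟩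
    rcases hy with rfl | hy
    · exact h4 y (Finset.mem_insert_self _ _)
    · exact (h2 y hy).trans fun z hz => h4 z (Finset.mem_insert_of_mem hz))
    σ (fun x hx => by rw [← hσ]; exact hx) ⟨∅, by simp⟩ ∅ (by simp) (by simp)
  rwa [Set.empty_union, hσ] at this

lemma foldl_spannerStep (hk : 1 ≤ p.k) (hB : 0 ≤ p.factor)
    (hn : (Fintype.card V : ℝ) ≤ p.factor ^ p.k)
    (hsize : (Fintype.card V : ℝ) * (p.m + 1) * p.factor ≤ p.spannerSize)
    (D : V → ℝ≥0∞) (σ : List (Sym2 V × W)) (hσ : {x | x ∈ σ} = tokensOf G w) :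
    IsGreedySpanner p.val D p.m p.k (σ.foldl (p.spannerStep D) ⟨∅, by simp⟩).1 (tokensOf G w) := by
  have := foldl_induction (p.spannerStep D) (tokensOf G w)
    (fun H P => IsGreedySpanner p.val D p.m p.k H.1 P) (by
    intro H P x hxP h
    unfold spannerStep
    split_ifs with hkeep
    -- The size bound holds for the enlarged spanner too, so the buffer never refuses a kept token.
    · have h1 := h.insert_of_keeps hk hkeep
      have h2 := h1.card_le hk hB hn hxP
      have h3 : (insert x H.1).card ≤ p.spannerSize := by exact_mod_cast h2.trans hsize
      rw [BoundedSet.push, dif_pos h3]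
      exact h1
    · exact h.insert_of_not_keeps hkeep)
    σ (fun x hx => by rw [← hσ]; exact hx) ⟨∅, by simp⟩ ∅ (by simp) isGreedySpanner_empty
  rwa [Set.empty_union, hσ] at this

lemma foldl_hookStep (hsize : Fintype.card V * (p.m + 1) ≤ p.hookSize)
    (D : V → ℝ≥0∞) (σ : List (Sym2 V × W)) (hσ : {x | x ∈ σ} = tokensOf G w) :
    IsHookSet p.val D p.m (σ.foldl (p.hookStep D) ⟨∅, by simp⟩).1 (tokensOf G w) := by
  have := foldl_induction (p.hookStep D) (tokensOf G w)
    (fun H P => IsHookSet p.val D p.m H.1 P) (by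
    intro H P x hxP h
    unfold hookStep
    split_ifs with hnew
    · have h1 := h.insert_of_isNewHook hnew
      have h3 : (insert x H.1).card ≤ p.hookSize := h1.card_le.trans hsize
      rw [BoundedSet.push, dif_pos h3]
      exact h1
    · exact h.insert_of_not_isNewHook hnew)
    σ (fun x hx => by rw [← hσ]; exact hx) ⟨∅, by simp⟩ ∅ (by simp) isHookSet_empty
  rwa [Set.empty_union, hσ] at this

lemma passRun_forest (σ : List (Sym2 V × W)) (F H K l S) :
    passRun p.step p.endPass σ (none, F, H, K, l, S) =
      PMF.pure (some false, σ.foldl p.forestStep F, H, K, l, S) := by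
  induction σ generalizing F with
  | nil => rfl
  | cons x σ ih =>
    rw [passRun, step, PMF.pure_bind, ih]
    rfl

lemma passRun_spanner (σ : List (Sym2 V × W)) (F H K l S) :
    passRun p.step p.endPass σ (some false, F, H, K, l, S) =
      PMF.pure (some true, F, σ.foldl (p.spannerStep (p.forestDist F.1)) H,
        σ.foldl (p.hookStep (p.forestDist F.1)) K, l, S) := by
  induction σ generalizing H K with
  | nil => rfl
  | cons x σ ih =>
    rw [passRun, step, PMF.pure_bind, ih]
    rfl

lemma passRun_sample (σ : List (Sym2 V × W)) (F H K l S) :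
    passRun p.step p.endPass σ (some true, F, H, K, l, S) =
      (sampleRun (fun x => ENNReal.ofReal (p.rate l.1 x)) p.bufferSize σ S).map fun S' =>
        (some true, F, H, K, p.record l (p.treeOf (F.1 ∪ H.1 ∪ K.1 ∪ S'.1)), ⟨∅, by simp⟩) := by
  induction σ generalizing S with
  | nil => rw [passRun, sampleRun, PMF.pure_map, endPass]
  | cons x σ ih =>
    rw [passRun, step, sampleRun, PMF.bind_bind, PMF.map_bind]
    congr 1
    funext b
    rw [PMF.pure_bind, ih]

end Passes

end Parameters

end Algorithm

/-! ### Multiplicative weights: analysis of the sampling rounds. -/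

lemma card_boundedSet_subtype_le {T : Type} [DecidableEq T] (U : Finset T) (L : ℕ) :
    Nat.card (BoundedSet {x // x ∈ U} L) ≤ (U.card + 1) ^ L := by
  have := card_boundedSet_le {x // x ∈ U} L
  simpa using this

namespace Parameters

variable {V W : Type} [Fintype V] {p : Parameters V W} {G : SimpleGraph V} {w : Sym2 V → W}

/-- The states after `i` successful sampling rounds. -/
def IsGoodState (p : Parameters V W) (G : SimpleGraph V) (w : Sym2 V → W)
    (σ : List (Sym2 V × W)) (F : BoundedSet (Sym2 V × W) (Fintype.card V))
    (H : BoundedSet (Sym2 V × W) p.spannerSize) (K : BoundedSet (Sym2 V × W) p.hookSize) (i : ℕ)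
    (st : p.State) : Prop :=
  ∃ l : p.History, st = (some true, F, H, K, l, ⟨∅, by simp⟩) ∧ l.1.length = i ∧
    (∀ T ∈ l.1, IsRoundTree p.val p.root (tokensOf G w) (F.1 : Set (Sym2 V × W))
      (H.1 : Set (Sym2 V × W)) (K.1 : Set (Sym2 V × W)) (T.1 : Set (Sym2 V × W))) ∧
    (σ.map (p.importance l.1)).sum ≤ p.totalBound i

/-- The relations between the parameters that the analysis of the sampling rounds needs; a sampling
round misses a set of total rate `a` with probability at most `exp (-a)`. -/
structure Suits (p : Parameters V W) (a : ℝ) : Prop where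
  k_pos : 1 ≤ p.k
  rounds_pos : 0 < p.rounds
  intensity_pos : 0 < p.intensity
  factor_pos : 0 < p.factor
  bufferSize : 3 * p.intensity ≤ p.bufferSize
  factor_mul : p.factor * a / p.intensity ≤ p.k / p.rounds

variable {a : ℝ}

lemma totalBound_pos (p : Parameters V W) (i : ℕ) : 0 < p.totalBound i := by
  have : 0 < Fintype.card V := Fintype.card_pos_iff.2 ⟨p.root⟩
  unfold totalBound
  positivity

lemma importance_nonneg (hp : p.Suits a) (l) (x : Sym2 V × W) : 0 ≤ p.importance l x :=
  pow_nonneg hp.factor_pos.le _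

lemma rate_nonneg (hp : p.Suits a) (l) (x : Sym2 V × W) : 0 ≤ p.rate l x := by
  have := importance_nonneg hp l x
  have := totalBound_pos p l.length
  have := hp.intensity_pos
  unfold rate
  positivity

lemma sum_rate_le (hp : p.Suits a) (l : List (BoundedSet (Sym2 V × W) (Fintype.card V)))
    (σ : List (Sym2 V × W))
    (h : (σ.map (p.importance l)).sum ≤ p.totalBound l.length) :
    (σ.map (p.rate l)).sum ≤ p.intensity := by
  have hQ := totalBound_pos p l.length
  have : (σ.map (p.rate l)).sum = p.intensity / p.totalBound l.length *
      (σ.map (p.importance l)).sum := by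
    rw [← List.sum_map_mul_left]
    congr 1
    refine List.map_congr_left fun x _ => ?_
    unfold rate
    ring
  rw [this, div_mul_eq_mul_div, div_le_iff₀ hQ]
  have := hp.intensity_pos
  gcongr

-- A new violation raises the importance of `x` by at most `factor` times its old value, which is `c
-- * p.rate l x`. Violated tokens have total rate at most `a`, so the total rises by at most `c *
-- a`, a fraction `factor * a / intensity ≤ k / rounds` of the bound.
open Classical in
lemma sum_importance_cons_le (hp : p.Suits a)
    (l : List (BoundedSet (Sym2 V × W) (Fintype.card V))) (T) (σ : List (Sym2 V × W))
    (h : (σ.map (p.importance l)).sum ≤ p.totalBound l.length)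
    (ha : (σ.map fun x => if Violates p.val p.root (T.1 : Set (Sym2 V × W)) x then p.rate l x
      else 0).sum ≤ a) :
    (σ.map (p.importance (T :: l))).sum ≤ p.totalBound (l.length + 1) := by
  have hQ := totalBound_pos p l.length
  have hs := hp.intensity_pos
  have hf := hp.factor_pos
  set c := p.factor * p.totalBound l.length / p.intensity with hc
  have hc0 : 0 ≤ c := by positivity
  have h1 : (σ.map (p.importance (T :: l))).sum ≤ (σ.map fun x => p.importance l x +
      c * if Violates p.val p.root (T.1 : Set (Sym2 V × W)) x then p.rate l x else 0).sum := by
    refine List.sum_le_sum fun x _ => ?_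
    have h0 := importance_nonneg hp l x
    unfold importance at h0 ⊢
    rw [violations_cons]
    split_ifs with hv
    · rw [pow_succ]
      have : c * p.rate l x = p.factor ^ p.violations l x * p.factor := by
        rw [hc, rate, importance]
        field_simp
      linarith
    · simp
  rw [List.sum_map_add, List.sum_map_mul_left] at h1
  refine h1.trans ?_
  calc _ ≤ p.totalBound l.length + c * a := by gcongr
    _ = p.totalBound l.length * (1 + p.factor * a / p.intensity) := by rw [hc]; field_simp
    _ ≤ p.totalBound l.length * (1 + p.k / p.rounds) :=
        mul_le_mul_of_nonneg_left (by linarith [hp.factor_mul]) hQ.le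
    _ = _ := by rw [totalBound, totalBound, pow_succ]; ring

variable [DecidableEq V]

/-- A sampling round succeeds with high probability. -/
theorem toOuterMeasure_round_le [DecidableEq W] (hp : p.Suits a) (σ : List (Sym2 V × W))
    (hσ : {x | x ∈ σ} = tokensOf G w) (F : BoundedSet (Sym2 V × W) (Fintype.card V))
    (H : BoundedSet (Sym2 V × W) p.spannerSize) (K : BoundedSet (Sym2 V × W) p.hookSize)
    (hF : (F.1 : Set (Sym2 V × W)) ⊆ tokensOf G w) (hH : (H.1 : Set (Sym2 V × W)) ⊆ tokensOf G w)
    (hK : (K.1 : Set (Sym2 V × W)) ⊆ tokensOf G w) (i : ℕ) (hi : i < p.rounds) (st : p.State)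
    (hst : p.IsGoodState G w σ F H K i st) :
    (passRun p.step p.endPass σ st).toOuterMeasure {st' | ¬ p.IsGoodState G w σ F H K (i + 1) st'} ≤
      ENNReal.ofReal (Real.exp (-p.intensity) +
        ((σ.toFinset.card : ℝ) + 1) ^ Fintype.card V * Real.exp (-a)) := by
  classical
  obtain ⟨l, rfl, rfl, hl, hsum⟩ := hst
  rw [passRun_sample, PMF.toOuterMeasure_map_apply]
  -- The tree depends on the sample, so the union bound runs over all sets of at most `n` stream
  -- tokens; `𝒯` keeps those whose violated tokens have rate at least `a`.
  let I := BoundedSet {x // x ∈ σ.toFinset} (Fintype.card V)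
  have : Fintype I := inferInstanceAs (Fintype {A : Finset {x // x ∈ σ.toFinset} // _})
  let X : I → Set (Sym2 V × W) := fun A =>
    {x | Violates p.val p.root (Subtype.val '' (A.1 : Set {x // x ∈ σ.toFinset})) x}
  let 𝒯 : Finset I := Finset.univ.filter fun A =>
    a ≤ (σ.map fun x => if x ∈ X A then p.rate l.1 x else 0).sum
  have hbad := toOuterMeasure_sampleRun_bad_le (L := p.bufferSize) (p.rate l.1)
    (rate_nonneg hp l.1) σ 𝒯 X p.intensity a hp.bufferSize (sum_rate_le hp l.1 σ hsum)
    (fun A hA => (Finset.mem_filter.1 hA).2)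
  refine le_trans (PMF.toOuterMeasure_mono _ ?_) (hbad.trans (ENNReal.ofReal_le_ofReal ?_))
  · rintro S ⟨hS, hsupp⟩
    by_contra hnot
    refine hS ?_
    have hSσ := (subset_of_mem_support_sampleRun _ σ _ S hsupp).2
    have hStok : (S.1 : Set (Sym2 V × W)) ⊆ tokensOf G w := by
      intro x hx
      rw [← hσ]
      exact (hSσ x hx).resolve_left (by simp)
    set A := F.1 ∪ H.1 ∪ K.1 ∪ S.1 with hA
    have hFA : F.1 ⊆ A := fun x hx => by simp [hA, hx]
    have hHA : H.1 ⊆ A := fun x hx => by simp [hA, hx]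
    have hKA : K.1 ⊆ A := fun x hx => by simp [hA, hx]
    have hSA : S.1 ⊆ A := fun x hx => by simp [hA, hx]
    have hAtok : (A : Set (Sym2 V × W)) ⊆ tokensOf G w := by
      rw [hA]
      push_cast
      exact Set.union_subset (Set.union_subset (Set.union_subset hF hH) hK) hStok
    obtain ⟨hTA, hTd⟩ := treeOf_spec (p := p) A hAtok
    set T := p.treeOf A with hT
    have hTtok : (T.1 : Set (Sym2 V × W)) ⊆ tokensOf G w := fun x hx => hAtok (hTA hx)
    have hTσ : ∀ x ∈ T.1, x ∈ σ.toFinset := by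
      intro x hx
      have : x ∈ {x | x ∈ σ} := by rw [hσ]; exact hTtok hx
      exact List.mem_toFinset.2 this
    have hcard : (T.1.subtype (· ∈ σ.toFinset)).card ≤ Fintype.card V := by
      rw [Finset.card_subtype]
      exact (Finset.card_filter_le _ _).trans T.2
    let B : I := ⟨T.1.subtype (· ∈ σ.toFinset), hcard⟩
    have hB : (Subtype.val '' (B.1 : Set {x // x ∈ σ.toFinset})) = (T.1 : Set (Sym2 V × W)) := by
      ext x
      simp only [B, Set.mem_image, Finset.mem_coe, Finset.mem_subtype, Subtype.exists,
        exists_and_left, exists_prop, exists_eq_right_right]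
      exact ⟨fun h => h.1, fun h => ⟨h, hTσ x h⟩⟩
    have hlight : (σ.map fun x => if Violates p.val p.root (T.1 : Set (Sym2 V × W)) x then
        p.rate l.1 x else 0).sum ≤ a := by
      -- Otherwise the new tree belongs to `𝒯`, and a good sample would contain a token violated by
      -- it.
      by_contra hcon
      refine hnot (Or.inr ⟨B, ?_, ?_⟩)
      · rw [Finset.mem_filter]
        refine ⟨Finset.mem_univ _, ?_⟩
        simp only [X, Set.mem_ofPred_eq, hB]
        exact (not_le.1 hcon).le
      · intro x hx hxX
        simp only [X, Set.mem_ofPred_eq, hB] at hxX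
        exact not_violates_of_mem hAtok hTd (hSA hx) hxX
    refine ⟨p.record l T, rfl, ?_, ?_, ?_⟩
    · rw [record, dif_pos hi, List.length_cons]
    · rw [record, dif_pos hi]
      intro T' hT'
      rcases List.mem_cons.1 hT' with rfl | hT'
      · exact ⟨hTtok, A, hAtok, hFA, hHA, hKA, hTd⟩
      · exact hl T' hT'
    · rw [record, dif_pos hi]
      exact sum_importance_cons_le hp l.1 T σ hsum hlight
  · gcongr
    have h1 : 𝒯.card ≤ (σ.toFinset.card + 1) ^ Fintype.card V := by
      refine (Finset.card_le_univ _).trans ?_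
      rw [← Nat.card_eq_fintype_card]
      exact card_boundedSet_subtype_le _ _
    exact_mod_cast h1

/-- All sampling rounds succeed with high probability. -/
theorem toOuterMeasure_rounds_le [DecidableEq W] (hp : p.Suits a) (σ : List (Sym2 V × W))
    (hσ : {x | x ∈ σ} = tokensOf G w) (F : BoundedSet (Sym2 V × W) (Fintype.card V))
    (H : BoundedSet (Sym2 V × W) p.spannerSize) (K : BoundedSet (Sym2 V × W) p.hookSize)
    (hF : (F.1 : Set (Sym2 V × W)) ⊆ tokensOf G w) (hH : (H.1 : Set (Sym2 V × W)) ⊆ tokensOf G w)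
    (hK : (K.1 : Set (Sym2 V × W)) ⊆ tokensOf G w) (hσc : σ.length ≤ Fintype.card V ^ 2)
    (hstart : F = σ.foldl p.forestStep ⟨∅, by simp⟩ ∧
      H = σ.foldl (p.spannerStep (p.forestDist F.1)) ⟨∅, by simp⟩ ∧
      K = σ.foldl (p.hookStep (p.forestDist F.1)) ⟨∅, by simp⟩) (i : ℕ) (hi : i ≤ p.rounds) :
    (multiRun p.init (passRun p.step p.endPass σ) (i + 2)).toOuterMeasure
        {st | ¬ p.IsGoodState G w σ F H K i st} ≤
      i * ENNReal.ofReal (Real.exp (-p.intensity) +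
        ((σ.toFinset.card : ℝ) + 1) ^ Fintype.card V * Real.exp (-a)) := by
  classical
  induction i with
  | zero =>
    rw [zero_add, multiRun, multiRun, multiRun, PMF.pure_bind, init, passRun_forest, PMF.pure_bind,
      passRun_spanner, ← hstart.1, ← hstart.2.1, ← hstart.2.2, PMF.toOuterMeasure_pure_apply,
      if_neg]
    · simp
    · simp only [Set.mem_ofPred_eq, not_not]
      refine ⟨⟨[], by simp⟩, rfl, rfl, by simp, ?_⟩
      -- Without trees every importance is `1`, so the total is the stream length.
      have h1 : σ.map (p.importance []) = σ.map fun _ => (1 : ℝ) :=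
        List.map_congr_left fun x _ => by simp [importance, violations]
      simp only [h1, totalBound, pow_zero, mul_one, List.map_const', List.sum_replicate,
        nsmul_eq_mul]
      exact_mod_cast hσc
  | succ i ih =>
    rw [show i + 1 + 2 = (i + 2) + 1 by ring, multiRun]
    refine (toOuterMeasure_bind_le _ _ {st | ¬ p.IsGoodState G w σ F H K i st} _
      (ENNReal.ofReal (Real.exp (-p.intensity) +
        ((σ.toFinset.card : ℝ) + 1) ^ Fintype.card V * Real.exp (-a)))
      fun st _ hst => ?_).trans ?_
    · exact toOuterMeasure_round_le hp σ hσ F H K hF hH hK i (by omega) st (by simpa using hst)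
    · rw [Nat.cast_add, Nat.cast_one, add_mul, one_mul]
      gcongr
      exact ih (by omega)

/-- After all sampling rounds have succeeded, the output is correct. -/
theorem IsGoodState.output_correct (hp : p.Suits a) {ε : ℝ} (hε : 0 < ε)
    (hcard : 2 ≤ Fintype.card V) (hfactor : p.factor ^ p.k = Fintype.card V)
    (hklog : (p.k : ℝ) ≤ Real.log (Fintype.card V))
    (hR : 24 * (p.k : ℝ) ^ 2 ≤ ε * p.rounds)
    (hm : 2 * (Fintype.card V : ℝ) ^ 3 ≤ ε * 2 ^ p.m)
    (σ : List (Sym2 V × W)) (hσ : {x | x ∈ σ} = tokensOf G w) {F H K}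
    (hF : (F.1 : Set (Sym2 V × W)) ⊆ tokensOf G w)
    (hFb : ∀ x ∈ tokensOf G w, BottleneckConnected p.val (F.1 : Set (Sym2 V × W)) x)
    (hH : IsGreedySpanner p.val (p.forestDist F.1) p.m p.k H.1 (tokensOf G w))
    (hK : IsHookSet p.val (p.forestDist F.1) p.m K.1 (tokensOf G w)) {st : p.State}
    (hst : p.IsGoodState G w σ F H K p.rounds st) :
    IsApproxShortestPathTree G (fun e => p.val (w e)) p.root ε (p.output st) := by
  classical
  obtain ⟨l, rfl, hlen, hl, hsum⟩ := hst
  have hn1 : (1 : ℝ) < Fintype.card V := by exact_mod_cast hcard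
  have hfac1 : 1 < p.factor := by
    by_contra hcon
    have := pow_le_one₀ (n := p.k) hp.factor_pos.le (not_lt.1 hcon)
    linarith
  have : Nonempty (Fin l.1.length) := ⟨⟨0, by rw [hlen]; exact hp.rounds_pos⟩⟩
  -- This is where `k ≤ log n` enters: `(1 + k / R) ^ R ≤ exp k ≤ n`, so the final total is at most
  -- `n ^ 3 = factor ^ (3 * k)`. A single importance cannot exceed it, which caps violations at `3 *
  -- k`.
  have htot : p.totalBound p.rounds ≤ p.factor ^ (3 * p.k) := by
    have hRpos : (0 : ℝ) < p.rounds := by exact_mod_cast hp.rounds_pos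
    have h1 : (1 + (p.k : ℝ) / p.rounds) ^ p.rounds ≤ Fintype.card V := by
      calc (1 + (p.k : ℝ) / p.rounds) ^ p.rounds ≤ (Real.exp (p.k / p.rounds)) ^ p.rounds := by
            gcongr
            linarith [Real.add_one_le_exp ((p.k : ℝ) / p.rounds)]
        _ = Real.exp p.k := by
            rw [← Real.exp_nat_mul]
            congr 1
            field_simp
        _ ≤ Real.exp (Real.log (Fintype.card V)) := Real.exp_le_exp.2 hklog
        _ = _ := Real.exp_log (by linarith)
    rw [totalBound, mul_comm 3, pow_mul, hfactor]
    calc _ ≤ (Fintype.card V : ℝ) ^ 2 * Fintype.card V := by gcongr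
      _ = _ := by ring
  refine isApproxShortestPathTree_of_rounds (m := p.m) (k := p.k) (F := F.1) (H := H.1) (K := K.1)
    hε hp.k_pos hF hFb hH hK
    (fun i : Fin l.1.length => ((l.1.get i).1 : Set (Sym2 V × W)))
    (fun i => hl _ (List.get_mem _ _)) ?_ ?_ hm ?_
  · intro x hx
    change p.violations l.1 x ≤ 3 * p.k
    have h1 : p.importance l.1 x ≤ (σ.map (p.importance l.1)).sum := by
      refine List.single_le_sum ?_ _ (List.mem_map_of_mem ?_)
      · intro y hy
        obtain ⟨z, -, rfl⟩ := List.mem_map.1 hy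
        exact importance_nonneg hp _ _
      · have : x ∈ {x | x ∈ σ} := by rw [hσ]; exact hx
        exact this
    exact (pow_le_pow_iff_right₀ hfac1).1 (h1.trans (hsum.trans htot))
  · simpa [hlen] using hR
  · exact Classical.epsilon_spec (exists_shortestPathTree _ _ _)

/-- The probability that the algorithm is correct. -/
theorem one_sub_le_toOuterMeasure_output [DecidableEq W] (hp : p.Suits a) {ε : ℝ} (hε : 0 < ε)
    (hcard : 2 ≤ Fintype.card V) (hfactor : p.factor ^ p.k = Fintype.card V)
    (hklog : (p.k : ℝ) ≤ Real.log (Fintype.card V))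
    (hR : 24 * (p.k : ℝ) ^ 2 ≤ ε * p.rounds)
    (hm : 2 * (Fintype.card V : ℝ) ^ 3 ≤ ε * 2 ^ p.m)
    (hspanner : (Fintype.card V : ℝ) * (p.m + 1) * p.factor ≤ p.spannerSize)
    (hhook : Fintype.card V * (p.m + 1) ≤ p.hookSize)
    (σ : List (Sym2 V × W)) (hσ : {x | x ∈ σ} = tokensOf G w) (hnodup : σ.Nodup) :
    1 - p.rounds * ENNReal.ofReal (Real.exp (-p.intensity) +
        (Fintype.card V : ℝ) ^ (2 * Fintype.card V) * Real.exp (-a)) ≤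
      ((multiRun p.init (passRun p.step p.endPass σ) (p.rounds + 2)).map p.output).toOuterMeasure
        {T | IsApproxShortestPathTree G (fun e => p.val (w e)) p.root ε T} := by
  set F := σ.foldl p.forestStep ⟨∅, by simp⟩ with hFdef
  set H := σ.foldl (p.spannerStep (p.forestDist F.1)) ⟨∅, by simp⟩ with hHdef
  set K := σ.foldl (p.hookStep (p.forestDist F.1)) ⟨∅, by simp⟩ with hKdef
  obtain ⟨hF, hFb⟩ := foldl_forestStep (p := p) σ hσ
  have hH := foldl_spannerStep (p := p) hp.k_pos hp.factor_pos.le hfactor.ge hspanner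
    (p.forestDist F.1) σ hσ
  have hK := foldl_hookStep (p := p) hhook (p.forestDist F.1) σ hσ
  -- The `+ 1` counts the empty slot when subsets are encoded, so the number of candidate trees is
  -- at most `n ^ (2 * n)`.
  have hc1 : σ.length + 1 ≤ Fintype.card V ^ 2 := by
    have h1 : σ.length ≤ G.edgeSet.ncard := by
      rw [← List.toFinset_card_of_nodup hnodup, ← Set.ncard_coe_finset]
      refine Set.ncard_le_ncard_of_injOn Prod.fst ?_ ?_ (Set.toFinite _)
      · intro x hx
        have : x ∈ {x | x ∈ σ} := by simpa using hx
        rw [hσ] at this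
        exact this.1
      · refine (injOn_fst_tokensOf G w).mono fun x hx => ?_
        rw [← hσ]; simpa using hx
    have h2 : G.edgeSet.ncard ≤ (Fintype.card V).choose 2 := by
      classical
      rw [← SimpleGraph.coe_edgeFinset, Set.ncard_coe_finset]
      exact G.card_edgeFinset_le_card_choose_two
    have h3 : (Fintype.card V).choose 2 ≤ Fintype.card V * (Fintype.card V - 1) := by
      rw [Nat.choose_two_right]
      exact Nat.div_le_self _ _
    obtain ⟨n, hn⟩ : ∃ n, Fintype.card V = n + 1 := ⟨Fintype.card V - 1, by omega⟩
    rw [hn] at h2 h3 hcard ⊢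
    simp only [Nat.add_sub_cancel] at h3
    nlinarith
  have hbad := toOuterMeasure_rounds_le hp σ hσ F H K hF hH.subset hK.subset (by omega)
    ⟨rfl, rfl, rfl⟩ p.rounds le_rfl
  have hgood := one_sub_le_toOuterMeasure_compl _ _ _ hbad
  rw [PMF.toOuterMeasure_map_apply]
  refine le_trans ?_ (hgood.trans (MeasureTheory.OuterMeasure.mono _ ?_))
  · gcongr
    rw [pow_mul]
    gcongr
    rw [List.toFinset_card_of_nodup hnodup]
    exact_mod_cast hc1
  · intro st hst
    have hst' : p.IsGoodState G w σ F H K p.rounds st := by simpa using hst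
    exact hst'.output_correct hp hε hcard hfactor hklog hR hm σ hσ hF hFb hH hK

end Parameters

/-! ### Memory in words, choice of parameters and the final bounds. -/

lemma setOf_mem_eq_tokensOf {V : Type} {b : ℕ} {G : SimpleGraph V} {w : Sym2 V → Word b}
    {σ : List (Sym2 V × Word b)} (h : IsInsertionStream G w σ) : {x | x ∈ σ} = tokensOf G w := by
  ext ⟨e, x⟩
  exact h.2 e x

/-- Two words name the edge and one its weight; the fourth makes room for the value "empty slot". -/
lemma card_token_add_one_le {n b : ℕ} (hn : 2 ≤ n) (hb : n ≤ 2 ^ b) :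
    Fintype.card (Sym2 (Fin n) × Word b) + 1 ≤ 2 ^ (b * 4) := by
  have hb1 : 1 ≤ b := by
    rcases Nat.eq_zero_or_pos b with rfl | h
    · simp at hb; omega
    · exact h
  have h1 : Fintype.card (Sym2 (Fin n)) ≤ n * n := by
    rw [Sym2.card, Fintype.card_fin, Nat.choose_two_right, Nat.add_sub_cancel]
    refine Nat.div_le_of_le_mul ?_
    nlinarith
  have h2 : Fintype.card (Word b) = 2 ^ b := by simp [Word]
  rw [Fintype.card_prod, h2]
  have h3 : 2 ≤ 2 ^ b := by
    calc 2 = 2 ^ 1 := by norm_num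
      _ ≤ 2 ^ b := Nat.pow_le_pow_right (by norm_num) hb1
  set y := 2 ^ b with hy
  rw [pow_mul, ← hy]
  have h4 : n * n ≤ y * y := Nat.mul_le_mul hb hb
  have h5 : Fintype.card (Sym2 (Fin n)) * y ≤ y * y * y := Nat.mul_le_mul_right _ (h1.trans h4)
  have h6 : 1 ≤ y * y * y := Nat.mul_pos (Nat.mul_pos (by omega) (by omega)) (by omega)
  calc _ ≤ y * y * y + y * y * y := by omega
    _ = 2 * (y * y * y) := by ring
    _ ≤ y * (y * y * y) := Nat.mul_le_mul_right _ h3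
    _ = y ^ 4 := by ring

lemma card_boundedSet_le_two_pow {T : Type} [Fintype T] {b : ℕ}
    (hT : Fintype.card T + 1 ≤ 2 ^ (b * 4)) (L : ℕ) :
    Nat.card (BoundedSet T L) ≤ 2 ^ (b * (4 * L)) := by
  refine (card_boundedSet_le T L).trans ((Nat.pow_le_pow_left hT L).trans (le_of_eq ?_))
  rw [← pow_mul, mul_assoc]

/-- The memory of the algorithm fits into words. -/
lemma Parameters.card_state_le {V W : Type} [Fintype V] [Fintype W] [DecidableEq V]
    (p : Parameters V W) {b : ℕ} (hb : 1 ≤ b)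
    (hT : Fintype.card (Sym2 V × W) + 1 ≤ 2 ^ (b * 4)) :
    Nat.card p.State ≤ 2 ^ (b * (2 + 4 * Fintype.card V + 4 * p.spannerSize + 4 * p.hookSize +
      (4 * Fintype.card V + 1) * p.rounds + 4 * p.bufferSize)) := by
  have hhist : Nat.card p.History ≤ 2 ^ (b * ((4 * Fintype.card V + 1) * p.rounds)) := by
    have : Fintype (BoundedSet (Sym2 V × W) (Fintype.card V)) := Fintype.ofFinite _
    refine (card_boundedList_le (BoundedSet (Sym2 V × W) (Fintype.card V)) p.rounds).trans ?_
    rw [← mul_assoc, pow_mul]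
    refine Nat.pow_le_pow_left ?_ _
    have h1 := card_boundedSet_le_two_pow hT (Fintype.card V)
    rw [Nat.card_eq_fintype_card] at h1
    have h2 : 2 ≤ 2 ^ b := by
      calc 2 = 2 ^ 1 := by norm_num
        _ ≤ 2 ^ b := Nat.pow_le_pow_right (by norm_num) hb
    rw [mul_add, pow_add, mul_one]
    have h3 : 1 ≤ 2 ^ (b * (4 * Fintype.card V)) := Nat.one_le_two_pow
    nlinarith
  have hphase : Nat.card (Option Bool) ≤ 2 ^ (b * 2) := by
    have : Nat.card (Option Bool) = 3 := by simp
    rw [this]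
    calc 3 ≤ 2 ^ (1 * 2) := by norm_num
      _ ≤ _ := Nat.pow_le_pow_right (by norm_num) (Nat.mul_le_mul_right _ hb)
  have hB := fun L => card_boundedSet_le_two_pow hT L
  rw [Nat.card_prod, Nat.card_prod, Nat.card_prod, Nat.card_prod, Nat.card_prod]
  refine (Nat.mul_le_mul hphase (Nat.mul_le_mul (hB _) (Nat.mul_le_mul (hB _)
    (Nat.mul_le_mul (hB _) (Nat.mul_le_mul hhist (hB _)))))).trans (le_of_eq ?_)
  simp only [← pow_add, ← mul_add]
  congr 2
  ring

/-- The algorithm which stores the whole graph. -/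
theorem exists_storing_algorithm (n b : ℕ) (s : Fin n) (val : Word b → ℝ≥0) (hn : 2 ≤ n)
    (hb : n ≤ 2 ^ b) :
    ∃ A : StreamingAlgorithm b (Sym2 (Fin n) × Word b) (SimpleGraph (Fin n)),
      A.space = 4 * n ^ 2 ∧ A.passes = 1 ∧
        ∀ (G : SimpleGraph (Fin n)) (w : Sym2 (Fin n) → Word b)
          (σ : List (Sym2 (Fin n) × Word b)), IsInsertionStream G w σ →
          (A.outputDist σ).toOuterMeasure
            {T | IsApproxShortestPathTree G (fun e => val (w e)) s 0 T} = 1 := by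
  let T := Sym2 (Fin n) × Word b
  obtain ⟨A, hspace, hpasses, hA⟩ := exists_streamingAlgorithm (M := BoundedSet T (n ^ 2))
    (card_boundedSet_le_two_pow (card_token_add_one_le hn hb) (n ^ 2)) 1 ⟨∅, by simp⟩
    (fun B x => PMF.pure (B.push x)) PMF.pure
    (fun B => Classical.epsilon fun O =>
      IsApproxShortestPathTree (graphOf (B.1 : Set T)) (weightOf val (B.1 : Set T)) s 0 O)
  refine ⟨A, hspace, hpasses, fun G w σ hσ => ?_⟩
  have htok := setOf_mem_eq_tokensOf hσ
  have hpass : ∀ (σ : List T) (B : BoundedSet T (n ^ 2)),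
      passRun (fun B x => PMF.pure (BoundedSet.push B x)) PMF.pure σ B =
        PMF.pure (σ.foldl BoundedSet.push B) := by
    intro σ
    induction σ with
    | nil => exact fun B => rfl
    | cons x σ ih =>
      intro B
      rw [passRun, PMF.pure_bind, ih]
      rfl
  have hfold : ((σ.foldl BoundedSet.push (⟨∅, by simp⟩ : BoundedSet T (n ^ 2))).1 : Set T) =
      tokensOf G w := by
    have := Parameters.foldl_induction (BoundedSet.push (T := T) (L := n ^ 2)) (tokensOf G w)
      (fun B P => (B.1 : Set T) = P) (by
        intro B P x hP hB
        have hcard : (insert x B.1).card ≤ n ^ 2 := by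
          rw [← Finset.card_image_of_injOn (f := Prod.fst) ((injOn_fst_tokensOf G w).mono (by
            rw [Finset.coe_insert, hB]; exact hP))]
          refine (Finset.card_le_univ _).trans ?_
          rw [Sym2.card, Fintype.card_fin, Nat.choose_two_right, Nat.add_sub_cancel]
          refine Nat.div_le_of_le_mul ?_
          nlinarith
        rw [BoundedSet.push, dif_pos hcard, Finset.coe_insert, hB])
      σ (fun x hx => by rw [← htok]; exact hx) ⟨∅, by simp⟩ ∅ (by simp) (by simp)
    rw [this, Set.empty_union, htok]
  rw [hA, multiRun, multiRun, PMF.pure_bind, hpass, PMF.pure_map, PMF.toOuterMeasure_pure_apply,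
    if_pos]
  have hg : graphOf (tokensOf G w) = G := by
    refine le_antisymm (graphOf_le subset_rfl) fun u v huv => ?_
    exact graphOf_adj.2 ⟨⟨(s(u, v), w s(u, v)), ⟨huv, rfl⟩, rfl⟩, huv.ne⟩
  have hspec := Classical.epsilon_spec (exists_shortestPathTree (graphOf (tokensOf G w))
    (weightOf val (tokensOf G w)) s)
  simp only [Set.mem_ofPred_eq, hfold]
  set O := Classical.epsilon fun O =>
    IsApproxShortestPathTree (graphOf (tokensOf G w)) (weightOf val (tokensOf G w)) s 0 O
  have hle : O ≤ G := hspec.le.trans hg.le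
  have hw : ∀ e ∈ (graphOf (tokensOf G w)).edgeSet,
      weightOf val (tokensOf G w) e = val (w e) := fun e he => weightOf_eq subset_rfl he
  refine ⟨hle, hspec.acyclic, hspec.reachable_of_adj, fun v => ?_, fun v => ?_⟩
  · rw [hspec.reachable_iff v, hg]
  · have := hspec.wdist_le v
    rw [wdist_congr_weight hw, wdist_congr_weight (G := O) (w' := fun e => val (w e)) fun e he =>
      hw e (SimpleGraph.edgeSet_mono hspec.le he), hg] at this
    exact this

lemma IsApproxShortestPathTree.mono {V : Type} {G T : SimpleGraph V} {w : Sym2 V → ℝ≥0} {s : V}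
    {ε ε' : ℝ} (h : IsApproxShortestPathTree G w s ε T) (hε : ε ≤ ε') :
    IsApproxShortestPathTree G w s ε' T :=
  ⟨h.le, h.acyclic, h.reachable_of_adj, h.reachable_iff, fun v => (h.wdist_le v).trans (by gcongr)⟩

/-- The failure probability of the sampling rounds. -/
lemma failure_le {n R : ℕ} {s : ℝ} (hn : 3 ≤ n) (hR : (R : ℝ) ≤ 25 * n ^ 3)
    (hs : 6 * n * Real.log n ≤ s) :
    R * (Real.exp (-s) + (n : ℝ) ^ (2 * n) * Real.exp (-(6 * n * Real.log n))) ≤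
      (n : ℝ) ^ (-(1 * n) : ℝ) := by
  have hn0 : (0 : ℝ) < n := by positivity
  have hn3 : (3 : ℝ) ≤ n := by exact_mod_cast hn
  have hexp : Real.exp (-(6 * n * Real.log n)) = ((n : ℝ) ^ (6 * n))⁻¹ := by
    rw [Real.exp_neg]
    congr 1
    rw [← Real.rpow_natCast, Real.rpow_def_of_pos hn0]
    push_cast
    ring_nf
  have h1 : Real.exp (-s) ≤ ((n : ℝ) ^ (6 * n))⁻¹ := by
    rw [← hexp]; exact Real.exp_le_exp.2 (by linarith)
  rw [hexp, one_mul, Real.rpow_neg hn0.le, Real.rpow_natCast]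
  have h2 : (1 : ℝ) ≤ (n : ℝ) ^ (2 * n) := one_le_pow₀ (by linarith)
  -- Of the exponent `6 * n`, the union bound consumes `2 * n` and the number of rounds `3 * n`; the
  -- remaining `n` is the failure exponent. Here `50 ≤ 3 ^ 4` and `7 ≤ 3 * n`.
  have h3 : (R : ℝ) * 2 ≤ (n : ℝ) ^ (3 * n) := by
    calc (R : ℝ) * 2 ≤ 50 * n ^ 3 := by linarith
      _ ≤ n ^ 4 * n ^ 3 := by
        gcongr
        nlinarith [pow_le_pow_left₀ (by norm_num) hn3 4]
      _ = (n : ℝ) ^ 7 := by ring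
      _ ≤ _ := pow_le_pow_right₀ (by linarith) (by omega)
  calc R * (Real.exp (-s) + (n : ℝ) ^ (2 * n) * ((n : ℝ) ^ (6 * n))⁻¹)
      ≤ R * ((n : ℝ) ^ (2 * n) * ((n : ℝ) ^ (6 * n))⁻¹ +
          (n : ℝ) ^ (2 * n) * ((n : ℝ) ^ (6 * n))⁻¹) := by
        gcongr
        exact h1.trans (le_mul_of_one_le_left (by positivity) h2)
    _ = (R * 2) * ((n : ℝ) ^ (2 * n) * ((n : ℝ) ^ (6 * n))⁻¹) := by ring
    _ ≤ (n : ℝ) ^ (3 * n) * ((n : ℝ) ^ (2 * n) * ((n : ℝ) ^ (6 * n))⁻¹) := by gcongr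
    _ = _ := by
      rw [show 6 * n = n + 3 * n + 2 * n by ring, pow_add, pow_add]
      field_simp

set_option maxHeartbeats 1000000 in
/-- The algorithm for `ε` that is not too small. -/
theorem exists_sampling_algorithm (n k b : ℕ) (ε : ℝ) (s : Fin n) (val : Word b → ℝ≥0)
    (hn : 3 ≤ n) (hk : 1 ≤ k) (hkn : (k : ℝ) ≤ Real.log n) (hε : 0 < ε) (hε1 : ε < 1)
    (hεn : 1 ≤ ε * n) (hb : n ≤ 2 ^ b) :
    ∃ A : StreamingAlgorithm b (Sym2 (Fin n) × Word b) (SimpleGraph (Fin n)),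
      (A.space : ℝ) ≤ 3000 * (k / ε * (n : ℝ) ^ (1 + 1 / (k : ℝ)) * Real.logb 2 n) ∧
      (A.passes : ℝ) ≤ 3000 * ((k : ℝ) ^ 2 / ε) ∧
        ∀ (G : SimpleGraph (Fin n)) (w : Sym2 (Fin n) → Word b)
          (σ : List (Sym2 (Fin n) × Word b)), IsInsertionStream G w σ →
          ENNReal.ofReal (1 - (n : ℝ) ^ (-(1 * n) : ℝ)) ≤ (A.outputDist σ).toOuterMeasure
            {T | IsApproxShortestPathTree G (fun e => val (w e)) s ε T} := by
  have hn0 : (0 : ℝ) < n := by positivity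
  have hn3 : (3 : ℝ) ≤ n := by exact_mod_cast hn
  have hk1 : (1 : ℝ) ≤ k := by exact_mod_cast hk
  have hb1 : 1 ≤ b := by
    rcases Nat.eq_zero_or_pos b with rfl | h
    · simp at hb; omega
    · exact h
  set B : ℝ := (n : ℝ) ^ (1 / (k : ℝ)) with hB
  set Λ : ℝ := Real.logb 2 n with hΛ
  set ℓ : ℕ := Nat.clog 2 n with hℓ
  set R : ℕ := ⌈24 * (k : ℝ) ^ 2 / ε⌉₊ with hR
  set a : ℝ := 6 * n * Real.log n with ha
  -- Chosen so that `B * a / I = k / R` exactly, the growth rate per round that `Suits` requires.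
  set I : ℝ := a * R * B / k with hI
  have hB1 : 1 ≤ B := Real.one_le_rpow (by linarith) (by positivity)
  have hBk : B ^ k = n := by
    rw [hB, ← Real.rpow_natCast, ← Real.rpow_mul hn0.le, one_div_mul_cancel (by positivity),
      Real.rpow_one]
  have hlog1 : 1 ≤ Real.log n := hk1.trans hkn
  have hlogΛ : Real.log n ≤ Λ := by
    rw [hΛ, Real.logb, le_div_iff₀ (Real.log_pos (by norm_num))]
    have := Real.log_two_lt_d9
    nlinarith
  have hΛ1 : 1 ≤ Λ := hlog1.trans hlogΛ
  have hℓΛ : (ℓ : ℝ) ≤ 2 * Λ := by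
    have h1 : 2 ^ (ℓ - 1) < n := by
      have := Nat.pow_pred_clog_lt_self (b := 2) (by norm_num) (show 1 < n by omega)
      simpa [hℓ] using this
    have h2 : ((ℓ - 1 : ℕ) : ℝ) ≤ Λ := by
      rw [hΛ, Real.le_logb_iff_rpow_le (by norm_num) hn0, Real.rpow_natCast]
      exact_mod_cast h1.le
    have h3 : (ℓ : ℝ) ≤ ((ℓ - 1 : ℕ) : ℝ) + 1 := by exact_mod_cast (by omega : ℓ ≤ ℓ - 1 + 1)
    linarith
  have hkε : 1 ≤ (k : ℝ) / ε := by rw [le_div_iff₀ hε]; linarith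
  have hk2ε : 1 ≤ (k : ℝ) ^ 2 / ε := by rw [le_div_iff₀ hε]; nlinarith
  have hRlow : 24 * (k : ℝ) ^ 2 / ε ≤ R := Nat.le_ceil _
  have hRup : (R : ℝ) ≤ 25 * ((k : ℝ) ^ 2 / ε) := by
    have h1 : (R : ℝ) ≤ 24 * (k : ℝ) ^ 2 / ε + 1 :=
      (Nat.ceil_lt_add_one (show 0 ≤ 24 * (k : ℝ) ^ 2 / ε by positivity)).le
    rw [mul_div_assoc] at h1
    linarith
  have hR0 : (0 : ℝ) < R := lt_of_lt_of_le (by positivity) hRlow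
  have hkR : (k : ℝ) ≤ R := by
    refine le_trans ?_ hRlow
    rw [le_div_iff₀ hε]
    nlinarith
  have ha0 : 0 < a := by positivity
  have haI : a ≤ I := by
    rw [hI, le_div_iff₀ (by positivity), mul_assoc a]
    refine mul_le_mul_of_nonneg_left ?_ ha0.le
    calc (k : ℝ) ≤ R * 1 := by linarith
      _ ≤ R * B := by gcongr
  have hI0 : 0 < I := ha0.trans_le haI
  let p : Parameters (Fin n) (Word b) :=
    { val := val
      root := s
      m := 5 * ℓ
      k := k
      spannerSize := ⌈(n : ℝ) * ((5 * ℓ : ℕ) + 1) * B⌉₊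
      hookSize := n * (5 * ℓ + 1)
      bufferSize := ⌈3 * I⌉₊
      rounds := R
      factor := B
      intensity := I }
  have hsuits : p.Suits a :=
    { k_pos := hk
      rounds_pos := by exact_mod_cast hR0
      intensity_pos := hI0
      factor_pos := by positivity
      bufferSize := Nat.le_ceil _
      factor_mul := by
        change B * a / I ≤ k / R
        rw [hI]
        refine le_of_eq ?_
        field_simp }
  obtain ⟨A, hspace, hpasses, hA⟩ := exists_streamingAlgorithm (M := p.State)
    (p.card_state_le hb1 (card_token_add_one_le (by omega) hb)) (R + 2) p.init p.step p.endPass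
    p.output
  refine ⟨A, ?_, ?_, fun G w σ hσ => ?_⟩
  · set X := k / ε * (n : ℝ) ^ (1 + 1 / (k : ℝ)) * Λ with hX
    have hXeq : X = k / ε * (n * B * Λ) := by
      rw [hX, Real.rpow_add hn0, Real.rpow_one]; ring
    have hnB : (n : ℝ) ≤ n * B := le_mul_of_one_le_right hn0.le hB1
    have hnBΛ : (n : ℝ) * B ≤ n * B * Λ := le_mul_of_one_le_right (by positivity) hΛ1
    have hY : (n : ℝ) * B * Λ ≤ X := by
      rw [hXeq]; exact le_mul_of_one_le_left (by positivity) hkε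
    have h1X : 1 ≤ X := by linarith
    have hm : ((5 * ℓ : ℕ) : ℝ) + 1 ≤ 11 * Λ := by push_cast; linarith
    have hsp : (p.spannerSize : ℝ) ≤ 12 * X := by
      have := (Nat.ceil_lt_add_one
        (show 0 ≤ (n : ℝ) * ((5 * ℓ : ℕ) + 1) * B by positivity)).le
      have h2 : (n : ℝ) * ((5 * ℓ : ℕ) + 1) * B ≤ n * (11 * Λ) * B := by gcongr
      change ((⌈(n : ℝ) * ((5 * ℓ : ℕ) + 1) * B⌉₊ : ℕ) : ℝ) ≤ 12 * X
      nlinarith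
    have hhk : (p.hookSize : ℝ) ≤ 11 * X := by
      change ((n * (5 * ℓ + 1) : ℕ) : ℝ) ≤ 11 * X
      have h2 : (n : ℝ) * ((5 * ℓ : ℕ) + 1) ≤ n * (11 * Λ) := by gcongr
      have h3 : (n : ℝ) * Λ ≤ n * B * Λ := by gcongr
      push_cast at h2 ⊢
      nlinarith
    -- Storing `R` trees costs about `n * k ^ 2 / ε` words; one factor `k` is paid by the logarithm.
    have hnR : (n : ℝ) * R ≤ 25 * X := by
      calc (n : ℝ) * R ≤ n * (25 * ((k : ℝ) ^ 2 / ε)) := by gcongr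
        _ = 25 * (k / ε * (n * k)) := by ring
        _ ≤ 25 * (k / ε * (n * B * Λ)) := by
          gcongr
          · exact hkn.trans hlogΛ
        _ = 25 * X := by rw [hXeq]
    have hbuf : (p.bufferSize : ℝ) ≤ 451 * X := by
      have := (Nat.ceil_lt_add_one (show 0 ≤ 3 * I by positivity)).le
      have h2 : I ≤ 150 * X := by
        calc I ≤ 6 * n * Λ * (25 * ((k : ℝ) ^ 2 / ε)) * B / k := by
              rw [hI, ha]; gcongr
          _ = 150 * X := by
            rw [hXeq]
            field_simp
            ring
      change ((⌈3 * I⌉₊ : ℕ) : ℝ) ≤ 451 * X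
      linarith
    rw [hspace]
    have hfin : Fintype.card (Fin n) = n := Fintype.card_fin n
    rw [hfin]
    push_cast
    change 2 + 4 * (n : ℝ) + 4 * p.spannerSize + 4 * p.hookSize + (4 * n + 1) * (R : ℝ) +
      4 * p.bufferSize ≤ 3000 * X
    have hRn : (R : ℝ) ≤ n * R := le_mul_of_one_le_left hR0.le (by linarith)
    have hexpand : (4 * n + 1) * (R : ℝ) = 4 * (n * R) + R := by ring
    linarith
  · rw [hpasses]
    push_cast
    linarith
  · have hmain := Parameters.one_sub_le_toOuterMeasure_output (G := G) (w := w) hsuits hε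
      (by rw [Fintype.card_fin]; omega) (by rw [Fintype.card_fin]; exact hBk)
      (by rw [Fintype.card_fin]; exact hkn)
      (by
        change 24 * (k : ℝ) ^ 2 ≤ ε * R
        rwa [div_le_iff₀' hε] at hRlow)
      (by
        rw [Fintype.card_fin]
        change 2 * (n : ℝ) ^ 3 ≤ ε * 2 ^ (5 * ℓ)
        have h1 : (n : ℝ) ≤ 2 ^ ℓ := by exact_mod_cast Nat.le_pow_clog (by norm_num) n
        -- Why `m = 5 * ℓ`: beyond `n ^ 3`, one factor `n` absorbs `1 / ε` and another the constant
        -- `2`.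
        calc 2 * (n : ℝ) ^ 3 ≤ (ε * n) * n * n ^ 3 := by gcongr; nlinarith
          _ = ε * n ^ 5 := by ring
          _ ≤ ε * (2 ^ ℓ) ^ 5 := by gcongr
          _ = _ := by rw [← pow_mul, mul_comm ℓ])
      (by rw [Fintype.card_fin]; exact Nat.le_ceil _) (by rw [Fintype.card_fin])
      σ (setOf_mem_eq_tokensOf hσ) hσ.1.of_map
    rw [hA]
    refine le_trans ?_ hmain
    rw [ENNReal.ofReal_sub _ (by positivity), ENNReal.ofReal_one, Fintype.card_fin]
    gcongr
    change (R : ℝ≥0∞) * ENNReal.ofReal (Real.exp (-I) + (n : ℝ) ^ (2 * n) * Real.exp (-a)) ≤ _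
    rw [← ENNReal.ofReal_natCast, ← ENNReal.ofReal_mul (by positivity)]
    refine ENNReal.ofReal_le_ofReal (failure_le hn ?_ haI)
    have h1 : (k : ℝ) ≤ n := hkn.trans ((Real.log_le_sub_one_of_pos hn0).trans (by linarith))
    have h2 : 1 / ε ≤ n := by rw [div_le_iff₀ hε]; linarith
    calc (R : ℝ) ≤ 25 * ((k : ℝ) ^ 2 / ε) := hRup
      _ = 25 * ((k : ℝ) ^ 2 * (1 / ε)) := by ring
      _ ≤ 25 * ((n : ℝ) ^ 2 * n) := by gcongr
      _ = _ := by ring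

end Streaming

theorem theorem4p1 :
    ∃ C c : ℝ, 0 < C ∧ 0 < c ∧
      ∀ (n k b : ℕ) (ε : ℝ) (s : Fin n) (val : Streaming.Word b → ℝ≥0),
        1 ≤ k → (k : ℝ) ≤ Real.log n → 0 < ε → ε < 1 → n ≤ 2 ^ b →
        ∃ A : Streaming.StreamingAlgorithm b (Sym2 (Fin n) × Streaming.Word b)
            (SimpleGraph (Fin n)),
          (A.space : ℝ) ≤ C * (k / ε * (n : ℝ) ^ (1 + 1 / (k : ℝ)) * Real.logb 2 n) ∧
          (A.passes : ℝ) ≤ C * ((k : ℝ) ^ 2 / ε) ∧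
          ∀ (G : SimpleGraph (Fin n)) (w : Sym2 (Fin n) → Streaming.Word b)
            (σ : List (Sym2 (Fin n) × Streaming.Word b)),
            Streaming.IsInsertionStream G w σ →
            ENNReal.ofReal (1 - (n : ℝ) ^ (-(c * n))) ≤
              (A.outputDist σ).toOuterMeasure
                {T | Streaming.IsApproxShortestPathTree G (fun e => val (w e)) s ε T} := by
  refine ⟨3000, 1, by norm_num, by norm_num, fun n k b ε s val hk hkn hε hε1 hb => ?_⟩
  have hk1 : (1 : ℝ) ≤ k := by exact_mod_cast hk
  have hn0' : 0 < n := Fin.pos s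
  have hn0 : (0 : ℝ) < n := by exact_mod_cast hn0'
  have hn : 3 ≤ n := by
    have h1 : Real.exp 1 ≤ n := (Real.le_log_iff_exp_le hn0).1 (hk1.trans hkn)
    have h2 := Real.exp_one_gt_d9
    have h3 : (2 : ℝ) < n := by linarith
    exact_mod_cast h3
  -- If `ε * n < 1`, then `n ≤ k / ε`, so `4 * n ^ 2` words for the whole graph fit the space bound.
  -- Otherwise `1 / ε ≤ n` keeps the number of rounds polynomial in `n`.
  by_cases hεn : 1 ≤ ε * n
  · exact Streaming.exists_sampling_algorithm n k b ε s val hn hk hkn hε hε1 hεn hb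
  obtain ⟨A, hspace, hpasses, hA⟩ := Streaming.exists_storing_algorithm n b s val (by omega) hb
  refine ⟨A, ?_, ?_, fun G w σ hσ => ?_⟩
  · have h1 : (n : ℝ) ≤ k / ε := by
      rw [le_div_iff₀ hε]; nlinarith
    have h2 : (n : ℝ) ≤ (n : ℝ) ^ (1 + 1 / (k : ℝ)) := by
      have : (1 : ℝ) ≤ n := by exact_mod_cast hn0'
      exact Real.self_le_rpow_of_one_le this (by simp)
    have h3 : 1 ≤ Real.logb 2 n := by
      rw [Real.le_logb_iff_rpow_le (by norm_num) hn0, Real.rpow_one]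
      exact_mod_cast (by omega : 2 ≤ n)
    rw [hspace]
    push_cast
    calc 4 * (n : ℝ) ^ 2 ≤ 3000 * (n * n * 1) := by nlinarith
      _ ≤ _ := by gcongr
  · rw [hpasses, Nat.cast_one]
    have : 1 ≤ (k : ℝ) ^ 2 / ε := by rw [le_div_iff₀ hε]; nlinarith
    linarith
  · refine le_trans ?_ (((A.outputDist σ).toOuterMeasure.mono
      fun T (hT : Streaming.IsApproxShortestPathTree _ _ _ _ T) => hT.mono hε.le).trans'
      (hA G w σ hσ).ge)
    rw [← ENNReal.ofReal_one]
    refine ENNReal.ofReal_le_ofReal ?_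
    have : (0 : ℝ) ≤ (n : ℝ) ^ (-(1 * n) : ℝ) := by positivity
    linarith
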